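/- Let $n\ge 1$ be an integer and $\beta\in\mathbb R$. For $\alpha>0$ let $$F^{(n)}_{\alpha,\beta}(x)=\sum_{r=0}^\infty \frac{x^r}{\Gamma(\beta+\alpha r)^n},\qquad x\in\mathbb R,$$ (with $1/\Gamma=0$ at the poles of $\Gamma$), let $\Delta(r,c)$ denote the list $\frac cr,\frac{c+1}r,\dots,\frac{c+r-1}r$, and let $$G^{q,0}_{p,q}\Big(z\,\Big|\,{a_1,\dots,a_p\atop b_1,\dots,b_q}\Big)=\frac1{2\pi i}\int_L z^{-s}\,\frac{\prod_{j=1}^q\Gamma(b_j+s)}{\prod_{i=1}^p\Gamma(a_i+s)}\,ds$$ be the Meijer $G$ function, where $L$ is a loop from $-\infty$ to $-\infty$ encircling all poles of the $\Gamma(b_j+s)$ once counterclockwise if $p<q$, or if $p=q$ and $|z|<1$, and a loop from $+\infty$ to $+\infty$ leaving all these poles on its left if $p>q$, or if $p=q$ and $|z|>1$. For positive integers $l,k$ and $y>0$ put $$m_{l/k,\beta}(n;y)=(2\pi)^{\frac{1-k}{2}-\frac{n(1-l)}{2}}\frac{k^{3/2}}{l^{n(\beta-\frac12)}}\,\frac1y\;G^{k,0}_{nl,k}\Big(\frac{l^{nl}y^k}{k^k}\,\Big|\,{\Delta(l,\beta),\dots,\Delta(l,\beta)\atop\Delta(k,1)}\Big)$$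 ($\Delta(l,\beta)$ repeated $n$ times), and $m_{l/k,\beta}(n;y)=0$ for $y\le 0$. Then, for $l=1$, $k=n$, i.e. $\alpha=1/n$, the following hold. 1. $m_{1/n,\beta}(n;\cdot)$ vanishes outside $[0,n]$, and for all $y>0$, $y\ne n$, $$m_{1/n,\beta}(n;y)=(2\pi)^{\frac{1-n}2}\,\frac{n^{3/2}}{y}\,G^{n,0}_{n,n}\Big(\frac{y^n}{n^n}\,\Big|\,{\beta,\dots,\beta\atop \frac1n,\frac2n,\dots,\frac nn}\Big)\,\Theta(n-y),$$ where $\Theta$ is the Heaviside function. 2. The series of $F^{(n)}_{1/n,\beta}(x)$ converges for every $x\in\mathbb R$, and if $\beta>\frac{n+1}{2n}$, then $m_{1/n,\beta}(n;\cdot)$ is its weight: for every $x\in\mathbb R$, $$F^{(n)}_{1/n,\beta}(-x)=\int_0^\infty e^{-xy}\,m_{1/n,\beta}(n;y)\,dy,$$ with an absolutely convergent integral. 3. If $\beta\ge\frac{n+1}{2n}$, then $m_{1/n,\beta}(n;y)\ge 0$ for all real $y\neq n$, and $x\mapsto F^{(n)}_{1/n,\beta}(-x)$ is completely monotone on $(0,\infty)$: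 it is $C^\infty$ there and $(-1)^r\frac{d^r}{dx^r}F^{(n)}_{1/n,\beta}(-x)\ge 0$ for all $x>0$ and $r=0,1,2,\dots$. -/

import Mathlib

open scoped ContDiff

noncomputable section

/-- The Mittag-Leffler function of Le Roy type, `∑ z ^ r / Γ(β + α r) ^ n`, at a real argument.
At a pole of `Γ` Mathlib has `Γ = 0`, so the corresponding term is `0` when `1 ≤ n`, which is the
value of the entire function `1 / Γ` there. -/
def leRoyML (α β : ℝ) (n : ℕ) (x : ℝ) : ℝ :=
  ∑' r : ℕ, x ^ r / Real.Gamma (β + α * r) ^ n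

/-- Complete monotonicity on a set `D` (used for the open half-line):
`f` is smooth on `D` and `(-1) ^ r f⁽ʳ⁾ ≥ 0` on `D` for all `r = 0, 1, 2, …`. -/
def CompletelyMonotoneOn (f : ℝ → ℝ) (D : Set ℝ) : Prop :=
  ContDiffOn ℝ ∞ f D ∧ ∀ r : ℕ, ∀ x ∈ D, 0 ≤ (-1 : ℝ) ^ r * iteratedDerivWithin r f D x

/-- The integrand `z ^ (-s) ∏ Γ(b_j + s) / ∏ Γ(a_i + s)` of the Mellin-Barnes integral of
`G^{q,0}_{p,q}(z | a; b)`, with `a` indexed by `p` elements and `b` by `q` elements. -/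
def meijerIntegrand {ι κ : Type} [Fintype ι] [Fintype κ] (a : ι → ℂ) (b : κ → ℂ) (z s : ℂ) : ℂ :=
  z ^ (-s) * (∏ j, Complex.Gamma (b j + s)) / ∏ i, Complex.Gamma (a i + s)

/-- Integral of `f` along the loop which comes from `-∞ - iR`, runs through `R - iR` and
`R + iR`, and goes back to `-∞ + iR`. -/
def leftLoopIntegral (f : ℂ → ℂ) (R : ℝ) : ℂ :=
  (∫ x in Set.Iic R, f (x - R * Complex.I)) + Complex.I * (∫ t in (-R)..R, f (R + t * Complex.I))
    - ∫ x in Set.Iic R, f (x + R * Complex.I)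

/-- Integral of `f` along the loop which comes from `+∞ - iR`, runs through `R - iR` and
`R + iR`, and goes back to `+∞ + iR`. -/
def rightLoopIntegral (f : ℂ → ℂ) (R : ℝ) : ℂ :=
  -(∫ x in Set.Ici R, f (x - R * Complex.I)) + Complex.I * (∫ t in (-R)..R, f (R + t * Complex.I))
    + ∫ x in Set.Ici R, f (x + R * Complex.I)

/-- The Meijer function `G^{q,0}_{p,q}(z | a; b)` as a Mellin-Barnes integral. With
`R = 1 + ∑ ‖b_j‖` both loops leave all the poles `-b_j - k` of the factors `Γ(b_j + s)` on their
left. The usual rule decides which loop is taken: the one around the left half-line if `p < q`, or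
`p = q` and `|z| < 1`; the one around the right half-line if `p > q`, or `p = q` and `|z| > 1`.
(For `p = q` the case `|z| = 1` is exceptional.) -/
def meijerGq0 {ι κ : Type} [Fintype ι] [Fintype κ] (a : ι → ℂ) (b : κ → ℂ) (z : ℂ) : ℂ :=
  open Classical in
  let R : ℝ := 1 + ∑ j, ‖b j‖
  (2 * Real.pi * Complex.I)⁻¹ *
    if Fintype.card ι < Fintype.card κ ∨ (Fintype.card ι = Fintype.card κ ∧ ‖z‖ < 1) then
      leftLoopIntegral (meijerIntegrand a b z) R
    else
      rightLoopIntegral (meijerIntegrand a b z) R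

/-- The sequence `Δ(r, c) = c / r, (c + 1) / r, …, (c + r - 1) / r`. -/
def deltaSeq (r : ℕ) (c : ℝ) (i : Fin r) : ℂ := (c + (i : ℕ)) / r

/-- The weight function `m_{l/k,β}(n; y)`, `y > 0`, of the Le Roy type function
`F^{(n)}_{l/k,β}`, extended by `0` to `y ≤ 0`:
`(2π)^((1-k)/2 - n(1-l)/2) k^(3/2) / l^(n(β-1/2)) y⁻¹`
times `G^{k,0}_{nl,k}(l^(nl) y^k / k^k | Δ(l,β), …, Δ(l,β); Δ(k,1))`, where `Δ(l,β)` is repeated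
`n` times. -/
def leRoyWeight (l k n : ℕ) (β y : ℝ) : ℝ :=
  if 0 < y then
    (2 * Real.pi) ^ ((1 - (k : ℝ)) / 2 - n * (1 - (l : ℝ)) / 2) * (k : ℝ) ^ (3 / 2 : ℝ)
      / (l : ℝ) ^ (n * (β - 1 / 2)) * (1 / y)
      * (meijerGq0 (fun i : Fin n × Fin l => deltaSeq l β i.2) (deltaSeq k 1)
          (((l : ℝ) ^ (n * l) * y ^ k / (k : ℝ) ^ k : ℝ) : ℂ)).re
  else 0

end

open Filter Topology MeasureTheory
open scoped unitInterval

/-! Put `M(s) = ∏ Γ(j/n + s) / Γ(β + s)^n` with `j = 1, …, n` (`gammaRatio`) and `G(z)` for the loop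
integral of `z^(-s) M(s)` divided by `2πi`, so that the weight is a constant times `G((y/n)^n) / y`.
Gauss's multiplication formula turns `M(r/n)` into a constant times `n^(-r) r! / Γ(β + r/n)^n`. Up
to scaling, the coefficients of `F` are therefore the numbers `M(r/n)/r!`, and the Laplace formula
reduces to the moment identity `∫₀¹ v^(r-1) G(v^n) dv = M(r/n)/n` (`leRoyG_moment`). The analytic
input is the bound `‖M(s)‖ ≤ C ‖s‖^((n+1)/2 - nβ)` away from the poles, obtained from Euler's limit
formula for `Γ` (`exists_norm_Gamma_div_le`). For `z > 1` the loop closes to the right over a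
pole-free region and `G(z) = 0`. For `z < 1`, Fubini and `∫₀¹ v^(r-ns-1) dv = 1/(r-ns)` turn the
moment into a loop integral of `M(s)/(r-ns)`. If `β > (n+1)/(2n)`, this integrand decays with an
exponent larger than one, so the loop opens to a vertical line, and Cauchy's formula on the right
half-plane returns `M(r/n)/n`. Positivity comes from Euler's product. The negative logarithmic
derivative of a partial product of `M` is a sum of terms `1/(j/n + k + w) - 1/(β + k + w)`. Its
derivatives alternate in sign by Jensen's inequality, because the mean of the `j/n` is `(n+1)/(2n) ≤
β`. Hence the partial products have alternating derivatives, and `M(r/n)` satisfies Hausdorff's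
difference inequalities (`sum_choose_realGammaRatio_nonneg`). For `β > (n+1)/(2n)` these say that
the density `G(v^n)/v` has nonnegative integral against all `v^a (1-v)^b`; Bernstein approximation
and continuity make it nonnegative, and continuity in `β` covers equality. Complete monotonicity of
`F(-x)` is read off the series and not off the weight: multiplied by an exponential, each derivative
has the Hausdorff differences as coefficients. This includes `β = (n+1)/(2n)`, where the integral
formula can fail: for `n = β = 1` the function is `exp(-x)`, but the weight vanishes for `y ≠ 1`. -/

/-! ### Uniform bounds for quotients of Gamma functions -/

/-- The part of the plane at distance at least one from the half-line of nonpositive reals, up to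
rounding: the real part is at least one, or the absolute value of the imaginary part is. -/
def farRegion : Set ℂ := {s | 1 ≤ s.re ∨ 1 ≤ |s.im|}

lemma one_le_norm_of_mem_farRegion {s : ℂ} (hs : s ∈ farRegion) : 1 ≤ ‖s‖ := by
  rcases hs with h | h
  · exact h.trans ((le_abs_self _).trans (Complex.abs_re_le_norm s))
  · exact h.trans (Complex.abs_im_le_norm s)

lemma add_mem_farRegion {s : ℂ} (hs : s ∈ farRegion) {b : ℝ} (hb : 0 ≤ b) :
    s + b ∈ farRegion := by
  rcases hs with h | h
  · left; simp only [Complex.add_re, Complex.ofReal_re]; linarith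
  · right; simpa using h

lemma one_add_re_sq_le {s : ℂ} (hs : s ∈ farRegion) : (1 + s.re ^ 2) / 2 ≤ ‖s‖ ^ 2 := by
  rw [Complex.sq_norm, Complex.normSq_apply]
  rcases hs with h | h
  · nlinarith [mul_self_nonneg s.im]
  · have : 1 ≤ |s.im| ^ 2 := one_le_pow₀ h
    rw [sq_abs] at this
    nlinarith [sq_nonneg s.re]

/-- On `[u, u + 1]` the derivative of `arctan` is at least a third of its value at `u`. This makes
sums of `1 / (1 + u²)` over unit steps telescope. -/
lemma inv_one_add_sq_le_arctan_sub (u : ℝ) :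
    1 / (1 + u ^ 2) ≤ 3 * (Real.arctan (u + 1) - Real.arctan u) := by
  have key := (convex_Icc u (u + 1)).mul_sub_le_image_sub_of_le_deriv (f := Real.arctan)
    (C := 1 / (3 * (1 + u ^ 2))) Real.continuous_arctan.continuousOn
    Real.differentiable_arctan.differentiableOn ?_ u (by simp) (u + 1) (by simp) (by simp)
  · have h0 : 0 < 1 + u ^ 2 := by positivity
    have : 1 / (3 * (1 + u ^ 2)) = 1 / (1 + u ^ 2) / 3 := by field_simp
    rw [this] at key
    linarith
  · intro x hx
    rw [interior_Icc] at hx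
    rw [Real.deriv_arctan]
    apply one_div_le_one_div_of_le (by positivity)
    nlinarith [hx.1, hx.2, sq_nonneg (u - 1), sq_nonneg u]

/-- After telescoping only the total variation of `arctan` remains, so the bound is independent of
both `N` and `s`, even when `Re s` is very negative. -/
lemma sum_inv_norm_sq_le {s : ℂ} (hs : s ∈ farRegion) (N : ℕ) :
    ∑ k ∈ Finset.range N, 1 / ‖s + k‖ ^ 2 ≤ 6 * Real.pi := by
  have h1 : ∀ k ∈ Finset.range N, 1 / ‖s + k‖ ^ 2 ≤
      6 * (Real.arctan (s.re + (k + 1 : ℕ)) - Real.arctan (s.re + k)) := by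
    intro k _
    have hk : s + k ∈ farRegion := by
      simpa using add_mem_farRegion hs (Nat.cast_nonneg k)
    have h2 := one_add_re_sq_le hk
    have h3 := inv_one_add_sq_le_arctan_sub (s.re + k)
    simp only [Complex.add_re, Complex.natCast_re] at h2
    push_cast
    rw [← add_assoc]
    have h4 : 1 / ‖s + k‖ ^ 2 ≤ 1 / ((1 + (s.re + k) ^ 2) / 2) :=
      one_div_le_one_div_of_le (by positivity) h2
    have h5 : 1 / ((1 + (s.re + k) ^ 2) / 2) = 2 * (1 / (1 + (s.re + k) ^ 2)) := by field_simp
    linarith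
  refine (Finset.sum_le_sum h1).trans ?_
  rw [← Finset.mul_sum, Finset.sum_range_sub (fun k : ℕ => Real.arctan (s.re + k))]
  simp only [Nat.cast_zero, add_zero]
  linarith [Real.arctan_lt_pi_div_two (s.re + N), Real.neg_pi_div_two_lt_arctan s.re]

lemma abs_log_norm_one_add_sub_re_le {u : ℂ} (hu : ‖u‖ ≤ 1 / 2) :
    |Real.log ‖1 + u‖ - u.re| ≤ ‖u‖ ^ 2 := by
  have h := Complex.norm_log_one_add_sub_self_le (z := u) (by linarith)
  have h1 := (Complex.abs_re_le_norm _).trans h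
  rw [Complex.sub_re, Complex.log_re] at h1
  refine h1.trans ?_
  have : (1 - ‖u‖)⁻¹ ≤ 2 := by
    rw [inv_le_comm₀ (by linarith) (by norm_num)]; linarith
  nlinarith [sq_nonneg ‖u‖]

lemma abs_log_norm_add_sub_le {a B : ℝ} {w : ℂ} (ha : |a| ≤ B) (hB : 0 < B) (hw : 2 * B ≤ ‖w‖) :
    |Real.log ‖a + w‖ - Real.log ‖w‖ - a * (1 / w).re| ≤ B ^ 2 / ‖w‖ ^ 2 ∧ (a : ℂ) + w ≠ 0 := by
  have hw0 : w ≠ 0 := norm_pos_iff.1 (by linarith)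
  have hn : ‖(a : ℂ) / w‖ ≤ 1 / 2 := by
    rw [norm_div, Complex.norm_real, Real.norm_eq_abs, div_le_iff₀ (by linarith)]; linarith
  have h1 := abs_log_norm_one_add_sub_re_le hn
  have h2 : (a : ℂ) + w = (1 + a / w) * w := by field_simp; ring
  have h3 : (1 : ℂ) + a / w ≠ 0 := by
    intro h
    have : (a : ℂ) / w = -1 := by linear_combination h
    rw [this, norm_neg, norm_one] at hn
    norm_num at hn
  refine ⟨?_, by rw [h2]; exact mul_ne_zero h3 hw0⟩
  rw [h2, norm_mul, Real.log_mul (norm_ne_zero_iff.2 h3) (norm_ne_zero_iff.2 hw0)]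
  have h4 : ((a : ℂ) / w).re = a * (1 / w).re := by
    rw [← Complex.re_ofReal_mul]; congr 1; field_simp
  have h5 : ‖(a : ℂ) / w‖ ^ 2 ≤ B ^ 2 / ‖w‖ ^ 2 := by
    rw [norm_div, div_pow, Complex.norm_real, Real.norm_eq_abs]
    gcongr
  rw [h4] at h1
  rw [show Real.log ‖1 + (a : ℂ) / w‖ + Real.log ‖w‖ - Real.log ‖w‖ - a * (1 / w).re
    = Real.log ‖1 + (a : ℂ) / w‖ - a * (1 / w).re by ring]
  exact h1.trans h5

/-- For large `w` the logarithms of `‖a + w‖ / ‖b + w‖` and of `(‖w + 1‖ / ‖w‖)^(a - b)` both equal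
`(a - b) Re(1/w) + O(‖w‖⁻²)`. The second expression telescopes along `w = s + k`. For bounded `w`
the factor `1/‖w‖²` is bounded below, so a large constant suffices. -/
lemma exists_factor_bound {B : ℝ} (hB : 1 ≤ B) : ∃ C : ℝ, ∀ a b : ℝ, |a| ≤ B → 0 ≤ b → b ≤ B →
    ∀ w ∈ farRegion,
      ‖a + w‖ / ‖b + w‖ ≤ Real.exp (C * (1 / ‖w‖ ^ 2)) * (‖w + 1‖ / ‖w‖) ^ (a - b) := by
  -- For `‖w‖ < 2B` the left side is at most `3B`, and the power on the right is at least `(2B +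
  -- 1)^(-2B)`.
  set K : ℝ := 3 * B * (2 * B + 1) ^ (2 * B) with hK
  have hK1 : 1 ≤ K := by
    have : 1 ≤ (2 * B + 1) ^ (2 * B) := Real.one_le_rpow (by linarith) (by linarith)
    nlinarith
  have hlK : 0 ≤ Real.log K := Real.log_nonneg hK1
  -- The first summand makes the exponential at least `K` when `‖w‖ < 2B`. The rest collects the
  -- expansion errors for large `w`: `B²` each from `a` and `b`, and `2B · B²` from the power.
  refine ⟨4 * B ^ 2 * Real.log K + (2 * B ^ 2 + 2 * B ^ 3), fun a b ha hb0 hbB w hw => ?_⟩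
  have hw1 : 1 ≤ ‖w‖ := one_le_norm_of_mem_farRegion hw
  have hw2 : 1 ≤ ‖w + 1‖ := by
    simpa using one_le_norm_of_mem_farRegion (add_mem_farRegion hw zero_le_one)
  have hbw : 1 ≤ ‖b + w‖ := by
    rw [add_comm]; exact one_le_norm_of_mem_farRegion (add_mem_farRegion hw hb0)
  have hb : |b| ≤ B := by rwa [abs_of_nonneg hb0]
  have hab : |a - b| ≤ 2 * B := (abs_sub a b).trans (by linarith)
  rcases le_or_gt (2 * B) ‖w‖ with hc | hc
  · obtain ⟨ea, na⟩ := abs_log_norm_add_sub_le ha (by linarith) hc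
    obtain ⟨eb, -⟩ := abs_log_norm_add_sub_le hb (by linarith) hc
    obtain ⟨e1, -⟩ := abs_log_norm_add_sub_le (a := 1) (B := B) (by simpa using hB) (by linarith) hc
    rw [Complex.ofReal_one, add_comm (1 : ℂ) w, one_mul] at e1
    have pa : 0 < ‖(a : ℂ) + w‖ := norm_pos_iff.2 na
    have h0 : 0 ≤ 1 / ‖w‖ ^ 2 := by positivity
    rw [← Real.log_le_log_iff (by positivity) (by positivity), Real.log_mul (by positivity)
      (by positivity), Real.log_exp, Real.log_rpow (by positivity),
      Real.log_div (by positivity) (by positivity), Real.log_div (by positivity) (by positivity)]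
    have e2 : |(a - b) * (Real.log ‖w + 1‖ - Real.log ‖w‖ - (1 / w).re)| ≤
        2 * B * (B ^ 2 / ‖w‖ ^ 2) := by
      rw [abs_mul]; gcongr
    have h6 : 0 ≤ 4 * B ^ 2 * Real.log K * (1 / ‖w‖ ^ 2) := by positivity
    have h7 : B ^ 2 / ‖w‖ ^ 2 = B ^ 2 * (1 / ‖w‖ ^ 2) := by ring
    rw [h7] at ea eb e1 e2
    have := abs_le.1 ea
    have := abs_le.1 eb
    have := abs_le.1 e2
    nlinarith
  · have h1 : ‖(a : ℂ) + w‖ / ‖b + w‖ ≤ 3 * B := by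
      rw [div_le_iff₀ (by linarith)]
      have : ‖(a : ℂ) + w‖ ≤ |a| + ‖w‖ := by
        simpa using norm_add_le (a : ℂ) w
      nlinarith
    have h2 : K ≤ Real.exp ((4 * B ^ 2 * Real.log K + (2 * B ^ 2 + 2 * B ^ 3)) * (1 / ‖w‖ ^ 2)) := by
      rw [← Real.log_le_iff_le_exp (by linarith), mul_one_div, le_div_iff₀ (by positivity)]
      have : ‖w‖ ^ 2 ≤ 4 * B ^ 2 := by nlinarith
      nlinarith [mul_le_mul_of_nonneg_left this hlK, pow_pos (by linarith : 0 < B) 3]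
    have h3 : (2 * B + 1) ^ (-(2 * B)) ≤ (‖w + 1‖ / ‖w‖) ^ (a - b) := by
      have hr : 0 < ‖w + 1‖ / ‖w‖ := by positivity
      have hlog : |Real.log (‖w + 1‖ / ‖w‖)| ≤ Real.log (2 * B + 1) := by
        rw [abs_le, ← Real.log_inv]
        constructor
        · apply Real.log_le_log (by positivity)
          rw [inv_eq_one_div]
          gcongr; linarith
        · apply Real.log_le_log hr
          rw [div_le_iff₀ (by linarith)]
          have : ‖w + 1‖ ≤ ‖w‖ + 1 := by simpa using norm_add_le w 1
          nlinarith
      rw [Real.rpow_def_of_pos (by linarith), Real.rpow_def_of_pos hr, Real.exp_le_exp]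
      have h8 : |Real.log (‖w + 1‖ / ‖w‖) * (a - b)| ≤ Real.log (2 * B + 1) * (2 * B) := by
        rw [abs_mul]; gcongr
        exact (abs_nonneg _).trans hlog
      linarith [(abs_le.1 h8).1]
    calc ‖(a : ℂ) + w‖ / ‖b + w‖ ≤ 3 * B := h1
      _ = K * (2 * B + 1) ^ (-(2 * B)) := by
        rw [hK, mul_assoc, ← Real.rpow_add (by linarith)]; simp
      _ ≤ _ := by gcongr

lemma prod_norm_div_le {a b C : ℝ} (hC : ∀ w ∈ farRegion,
      ‖a + w‖ / ‖b + w‖ ≤ Real.exp (C * (1 / ‖w‖ ^ 2)) * (‖w + 1‖ / ‖w‖) ^ (a - b))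
    {s : ℂ} (hs : s ∈ farRegion) (N : ℕ) :
    ∏ k ∈ Finset.range N, (‖a + s + k‖ / ‖b + s + k‖) ≤
      Real.exp (|C| * (6 * Real.pi)) * (‖s + N‖ / ‖s‖) ^ (a - b) := by
  have hmem : ∀ k : ℕ, s + k ∈ farRegion := fun k => by
    simpa using add_mem_farRegion hs (Nat.cast_nonneg k)
  have hpos : ∀ k : ℕ, 0 < ‖s + k‖ := fun k => by
    linarith [one_le_norm_of_mem_farRegion (hmem k)]
  calc _ ≤ ∏ k ∈ Finset.range N, (Real.exp (C * (1 / ‖s + k‖ ^ 2)) *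
        (‖s + (k + 1 : ℕ)‖ / ‖s + k‖) ^ (a - b)) := by
        apply Finset.prod_le_prod
        · intros; positivity
        · intro k _
          have := hC _ (hmem k)
          push_cast
          simpa only [add_assoc] using this
    _ = Real.exp (C * ∑ k ∈ Finset.range N, 1 / ‖s + k‖ ^ 2) * (‖s + N‖ / ‖s‖) ^ (a - b) := by
        rw [Finset.prod_mul_distrib, ← Real.exp_sum, ← Finset.mul_sum,
          Real.finsetProd_rpow _ _ (fun k _ => (div_pos (hpos _) (hpos _)).le)]
        congr 2
        -- The telescoping identity is stated for a commutative group, hence the passage to units of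
        -- `ℝ`.
        have := Finset.prod_range_div (fun k : ℕ => Units.mk0 ‖s + k‖ (hpos k).ne') N
        have := congrArg Units.val this
        simpa [Units.coe_prod] using this
    _ ≤ _ := by
        gcongr ?_ * _
        apply Real.exp_le_exp.2
        have h0 : 0 ≤ ∑ k ∈ Finset.range N, 1 / ‖s + k‖ ^ 2 :=
          Finset.sum_nonneg fun k _ => by positivity
        calc _ ≤ |C| * ∑ k ∈ Finset.range N, 1 / ‖s + k‖ ^ 2 := by
              gcongr; exact le_abs_self C
          _ ≤ _ := by gcongr; exact sum_inv_norm_sq_le hs N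

lemma tendsto_norm_add_natCast_div (s : ℂ) :
    Tendsto (fun N : ℕ => ‖s + (N + 1 : ℕ)‖ / N) atTop (𝓝 1) := by
  have h1 : Tendsto (fun N : ℕ => (s + 1) / (N : ℂ) + 1) atTop (𝓝 (0 + 1)) :=
    (tendsto_const_div_atTop_nhds_zero_nat (s + 1)).add_const 1
  have h2 := h1.norm
  rw [zero_add, norm_one] at h2
  refine h2.congr' ?_
  filter_upwards [eventually_ge_atTop 1] with N hN
  have : (N : ℂ) ≠ 0 := by exact_mod_cast (by lia : N ≠ 0)
  rw [← Complex.norm_natCast (n := N), ← norm_div]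
  congr 1
  push_cast
  field_simp
  ring

/-- A substitute for Stirling's formula. In the quotient of the Euler sequences the factorials
cancel, leaving `N^(b-a) ∏ ‖a+s+k‖/‖b+s+k‖`; the product bound is at most a constant times
`(‖s+N+1‖/N)^(a-b) ‖s‖^(b-a)`, and the first power tends to one. Only `a` may be negative, so no
pole of the numerator comes near. -/
theorem exists_norm_Gamma_div_le (B : ℝ) : ∃ C : ℝ, 0 ≤ C ∧ ∀ a b : ℝ, |a| ≤ B → 0 ≤ b → b ≤ B →
    ∀ s ∈ farRegion,
      ‖Complex.Gamma (b + s) / Complex.Gamma (a + s)‖ ≤ C * ‖s‖ ^ (b - a) := by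
  obtain ⟨C, hC⟩ := exists_factor_bound (le_max_right B 1)
  refine ⟨Real.exp (|C| * (6 * Real.pi)), by positivity, fun a b ha hb0 hbB s hs => ?_⟩
  have hs1 := one_le_norm_of_mem_farRegion hs
  -- `Γ(a + s) = 0` is the default value at a pole; the quotient is then `0`, which agrees with `1/Γ
  -- = 0` there.
  rcases eq_or_ne (Complex.Gamma (a + s)) 0 with h0 | h0
  · rw [h0, div_zero, norm_zero]; positivity
  have hlim := ((Complex.GammaSeq_tendsto_Gamma (b + s)).div
    (Complex.GammaSeq_tendsto_Gamma (a + s)) h0).norm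
  have hlim2 : Tendsto (fun N : ℕ => Real.exp (|C| * (6 * Real.pi)) *
      ((‖s + (N + 1 : ℕ)‖ / N) ^ (a - b) * ‖s‖ ^ (b - a))) atTop
      (𝓝 (Real.exp (|C| * (6 * Real.pi)) * (1 ^ (a - b) * ‖s‖ ^ (b - a)))) :=
    (((tendsto_norm_add_natCast_div s).rpow_const (Or.inl one_ne_zero)).mul_const _).const_mul _
  rw [Real.one_rpow, one_mul] at hlim2
  refine le_of_tendsto_of_tendsto hlim hlim2 ?_
  filter_upwards [eventually_ge_atTop 1] with N hN
  have hN0 : (0 : ℝ) < N := by exact_mod_cast hN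
  have hNc : (N : ℂ) ≠ 0 := by exact_mod_cast (by lia : N ≠ 0)
  have hp := prod_norm_div_le (hC a b (ha.trans (le_max_left _ _)) hb0 (hbB.trans (le_max_left _ _)))
    hs (N + 1)
  have hfac : (N.factorial : ℂ) ≠ 0 := by exact_mod_cast N.factorial_ne_zero
  have heq : ‖(Complex.GammaSeq (b + s) / Complex.GammaSeq (a + s)) N‖ =
      (N : ℝ) ^ (b - a) * ∏ k ∈ Finset.range (N + 1), (‖a + s + k‖ / ‖b + s + k‖) := by
    rw [Pi.div_apply, Complex.GammaSeq, Complex.GammaSeq, Finset.prod_div_distrib,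
      ← norm_prod, ← norm_prod]
    rw [div_div_div_eq, norm_div, norm_mul, norm_mul, norm_mul, norm_mul,
      ← Complex.ofReal_natCast, Complex.norm_cpow_eq_rpow_re_of_pos hN0,
      Complex.norm_cpow_eq_rpow_re_of_pos hN0]
    simp only [Complex.add_re, Complex.ofReal_re]
    rw [Real.rpow_add hN0, Real.rpow_add hN0, Real.rpow_sub hN0]
    have h1 : (N : ℝ) ^ s.re ≠ 0 := by positivity
    have h2 : ‖(N.factorial : ℂ)‖ ≠ 0 := norm_ne_zero_iff.2 hfac
    have h3 : (N : ℝ) ^ a ≠ 0 := by positivity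
    field_simp
  rw [heq]
  calc _ ≤ (N : ℝ) ^ (b - a) * (Real.exp (|C| * (6 * Real.pi)) *
        (‖s + (N + 1 : ℕ)‖ / ‖s‖) ^ (a - b)) := by gcongr
    _ = _ := by
      rw [Real.div_rpow (by positivity) (by positivity), Real.div_rpow (by positivity)
        (by positivity), show b - a = -(a - b) by ring, Real.rpow_neg (by positivity),
        Real.rpow_neg (by positivity)]
      ring

/-! ### Cauchy's theorem on unbounded regions -/

lemma setIntegral_Ioi_eq_add (f : ℝ → ℂ) (a : ℝ) :
    ∫ x in Set.Ioi a, f x = ∫ x in Set.Ioi (0 : ℝ), f (a + x) := by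
  rw [← (measurePreserving_add_left volume a).setIntegral_preimage_emb
    (measurableEmbedding_addLeft a) f (Set.Ioi a)]
  simp

lemma setIntegral_Iic_eq_sub (f : ℝ → ℂ) (a : ℝ) :
    ∫ x in Set.Iic a, f x = ∫ x in Set.Ioi (0 : ℝ), f (a - x) := by
  have h := integral_comp_neg_Ioi (-a) f
  rw [neg_neg] at h
  rw [← h, setIntegral_Ioi_eq_add]
  simp [neg_add_eq_sub]

/-- Cauchy's theorem on a half-strip. -/
theorem integral_boundary_halfStrip {g : ℂ → ℂ} {a p q : ℝ} (hpq : p ≤ q) {B : ℝ → ℝ}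
    (hg : ∀ x y : ℝ, a ≤ x → y ∈ Set.Icc p q → DifferentiableAt ℂ g (x + y * Complex.I))
    (hb : ∀ x y : ℝ, a ≤ x → y ∈ Set.Icc p q → ‖g (x + y * Complex.I)‖ ≤ B x)
    (hB : IntegrableOn B (Set.Ioi a)) (hB0 : Tendsto B atTop (𝓝 0)) :
    (∫ x in Set.Ioi a, g (x + p * Complex.I)) - (∫ x in Set.Ioi a, g (x + q * Complex.I)) =
      Complex.I * ∫ y in p..q, g (a + y * Complex.I) := by
  have hint : ∀ y ∈ Set.Icc p q, IntegrableOn (fun x : ℝ => g (x + y * Complex.I)) (Set.Ioi a) := by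
    intro y hy
    refine Integrable.mono' hB ?_ ?_
    · refine ContinuousOn.aestronglyMeasurable (fun x hx => ?_) measurableSet_Ioi
      have h1 := (hg x y (le_of_lt hx) hy).continuousAt
      exact ContinuousAt.continuousWithinAt
        (ContinuousAt.comp (f := fun x : ℝ => (x : ℂ) + y * Complex.I) h1 (by fun_prop))
    · filter_upwards [ae_restrict_mem measurableSet_Ioi] with x hx
      exact hb x y (le_of_lt hx) hy
  have h1 := intervalIntegral_tendsto_integral_Ioi a (hint p ⟨le_rfl, hpq⟩) tendsto_id
  have h2 := intervalIntegral_tendsto_integral_Ioi a (hint q ⟨hpq, le_rfl⟩) tendsto_id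
  have h3 : Tendsto (fun X : ℝ => ∫ y in p..q, g (X + y * Complex.I)) atTop (𝓝 0) := by
    have h4 : Tendsto (fun X => B X * |q - p|) atTop (𝓝 0) := by simpa using hB0.mul_const |q - p|
    refine squeeze_zero_norm' ?_ h4
    filter_upwards [eventually_ge_atTop a] with X hX
    apply intervalIntegral.norm_integral_le_of_norm_le_const
    intro y hy
    rw [Set.uIoc_of_le hpq] at hy
    exact hb X y hX (Set.Ioc_subset_Icc_self hy)
  have h5 := (h1.sub h2).add (h3.const_mul Complex.I)
  rw [mul_zero, add_zero] at h5
  refine tendsto_nhds_unique h5 (tendsto_const_nhds.congr' ?_)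
  filter_upwards [eventually_ge_atTop a] with X hX
  have hr := Complex.integral_boundary_rect_eq_zero_of_differentiableOn g
    (a + p * Complex.I) (X + q * Complex.I) ?_
  · simp only [Complex.add_re, Complex.ofReal_re, Complex.mul_re, Complex.I_re, mul_zero,
      Complex.ofReal_im, Complex.I_im, mul_one, sub_self, add_zero, Complex.add_im,
      Complex.mul_im, zero_add, smul_eq_mul] at hr
    simp only [id]
    linear_combination -hr
  · intro s hs
    rw [Complex.mem_reProdIm] at hs
    simp only [Complex.add_re, Complex.ofReal_re, Complex.mul_re, Complex.I_re, mul_zero,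
      Complex.ofReal_im, Complex.I_im, mul_one, sub_self, add_zero, Complex.add_im,
      Complex.mul_im, zero_add, Set.uIcc_of_le hX, Set.uIcc_of_le hpq] at hs
    have := hg s.re s.im hs.1.1 hs.2
    rw [Complex.re_add_im] at this
    exact this.differentiableWithinAt

lemma integrableOn_one_add_norm_rpow {r : ℝ} (hr : 1 < r) (C : ℝ) (s : Set ℝ) :
    IntegrableOn (fun x : ℝ => C * (1 + |x|) ^ (-r)) s := by
  have := (integrable_one_add_norm (E := ℝ) (μ := volume) (r := r) (by simpa using hr)).const_mul C
  exact this.integrableOn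

lemma tendsto_one_add_abs_rpow {r : ℝ} (hr : 0 < r) (C : ℝ) :
    Tendsto (fun x : ℝ => C * (1 + |x|) ^ (-r)) atTop (𝓝 0) := by
  have h := (tendsto_rpow_neg_atTop hr).comp
    (tendsto_atTop_add_const_left atTop (1 : ℝ) tendsto_abs_atTop_atTop)
  simpa using h.const_mul C

lemma one_add_norm_rpow_le {r : ℝ} (hr : 0 ≤ r) {s : ℂ} {x : ℝ} (h : |x| ≤ ‖s‖) :
    (1 + ‖s‖) ^ (-r) ≤ (1 + |x|) ^ (-r) :=
  Real.rpow_le_rpow_of_nonpos (by positivity) (by linarith) (by linarith)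

/-- Cauchy's theorem on the first quadrant. -/
theorem integral_boundary_quadrant {g : ℂ → ℂ} {C r : ℝ} (hr : 1 < r)
    (hg : ∀ x y : ℝ, 0 ≤ x → 0 ≤ y → DifferentiableAt ℂ g (x + y * Complex.I))
    (hb : ∀ x y : ℝ, 0 ≤ x → 0 ≤ y →
      ‖g (x + y * Complex.I)‖ ≤ C * (1 + ‖(x + y * Complex.I : ℂ)‖) ^ (-r)) :
    ∫ x in Set.Ioi (0 : ℝ), g x = Complex.I * ∫ y in Set.Ioi (0 : ℝ), g (y * Complex.I) := by
  have hC : 0 ≤ C := by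
    have := (norm_nonneg _).trans (hb 0 0 le_rfl le_rfl)
    simpa using this
  have hbx : ∀ x y : ℝ, 0 ≤ x → 0 ≤ y → ‖g (x + y * Complex.I)‖ ≤ C * (1 + |x|) ^ (-r) := by
    intro x y hx hy
    refine (hb x y hx hy).trans ?_
    refine mul_le_mul_of_nonneg_left (one_add_norm_rpow_le (by linarith) ?_) hC
    simpa using Complex.abs_re_le_norm (x + y * Complex.I)
  have hby : ∀ x y : ℝ, 0 ≤ x → 0 ≤ y → ‖g (x + y * Complex.I)‖ ≤ C * (1 + |y|) ^ (-r) := by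
    intro x y hx hy
    refine (hb x y hx hy).trans ?_
    refine mul_le_mul_of_nonneg_left (one_add_norm_rpow_le (by linarith) ?_) hC
    simpa using Complex.abs_im_le_norm (x + y * Complex.I)
  have hcont : ∀ y : ℝ, 0 ≤ y → ContinuousOn (fun x : ℝ => g (x + y * Complex.I)) (Set.Ioi 0) := by
    intro y hy x hx
    exact ContinuousAt.continuousWithinAt (ContinuousAt.comp
      (f := fun x : ℝ => (x : ℂ) + y * Complex.I) (hg x y (le_of_lt hx) hy).continuousAt
      (by fun_prop))
  -- The upper side of the half-strip `0 ≤ Im s ≤ q` contributes nothing in the limit `q → ∞`.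
  have h1 : Tendsto (fun q : ℝ => ∫ x in Set.Ioi (0 : ℝ), g (x + q * Complex.I)) atTop
      (𝓝 (∫ _ in Set.Ioi (0 : ℝ), 0)) := by
    refine tendsto_integral_filter_of_dominated_convergence (fun x => C * (1 + |x|) ^ (-r))
      ?_ ?_ (integrableOn_one_add_norm_rpow hr C _) ?_
    · filter_upwards [eventually_ge_atTop 0] with q hq
      exact (hcont q hq).aestronglyMeasurable measurableSet_Ioi
    · filter_upwards [eventually_ge_atTop 0] with q hq
      filter_upwards [ae_restrict_mem measurableSet_Ioi] with x hx
      exact hbx x q (le_of_lt hx) hq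
    · filter_upwards [ae_restrict_mem measurableSet_Ioi] with x hx
      refine squeeze_zero_norm' ?_ (tendsto_one_add_abs_rpow (by linarith : 0 < r) C)
      filter_upwards [eventually_ge_atTop 0] with q hq
      exact hby x q (le_of_lt hx) hq
  rw [integral_zero] at h1
  have h2 : Tendsto (fun q : ℝ => ∫ y in (0 : ℝ)..q, g (y * Complex.I)) atTop
      (𝓝 (∫ y in Set.Ioi (0 : ℝ), g (y * Complex.I))) := by
    refine intervalIntegral_tendsto_integral_Ioi 0 ?_ tendsto_id
    refine Integrable.mono' (integrableOn_one_add_norm_rpow hr C _) ?_ ?_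
    · refine ContinuousOn.aestronglyMeasurable (fun y hy => ?_) measurableSet_Ioi
      have := (hg 0 y le_rfl (le_of_lt hy)).continuousAt
      rw [Complex.ofReal_zero, zero_add] at this
      exact ContinuousAt.continuousWithinAt (ContinuousAt.comp
        (f := fun y : ℝ => (y : ℂ) * Complex.I) this (by fun_prop))
    · filter_upwards [ae_restrict_mem measurableSet_Ioi] with y hy
      simpa using hby 0 y le_rfl (le_of_lt hy)
  refine tendsto_nhds_unique ?_ (h2.const_mul Complex.I)
  have h3 := h1.const_sub (∫ x in Set.Ioi (0 : ℝ), g x)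
  rw [sub_zero] at h3
  refine h3.congr' ?_
  filter_upwards [eventually_ge_atTop 0] with q hq
  have := integral_boundary_halfStrip (a := 0) hq (g := g) (B := fun x => C * (1 + |x|) ^ (-r))
    (fun x y hx hy => hg x y hx hy.1) (fun x y hx hy => hbx x y hx hy.1)
    (integrableOn_one_add_norm_rpow hr C _) (tendsto_one_add_abs_rpow (by linarith) C)
  simpa using this

/-- Cauchy's theorem on a quadrant with corner `p` and first side in the direction `d`. -/
theorem integral_boundary_rotated_quadrant {g : ℂ → ℂ} {C r : ℝ} (hr : 1 < r) (p d : ℂ)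
    (hd : ‖d‖ = 1)
    (hg : ∀ x y : ℝ, 0 ≤ x → 0 ≤ y → DifferentiableAt ℂ g (p + d * (x + y * Complex.I)))
    (hb : ∀ x y : ℝ, 0 ≤ x → 0 ≤ y → ‖g (p + d * (x + y * Complex.I))‖ ≤
      C * (1 + ‖p + d * (x + y * Complex.I)‖) ^ (-r)) :
    ∫ x in Set.Ioi (0 : ℝ), g (p + d * x) =
      Complex.I * ∫ y in Set.Ioi (0 : ℝ), g (p + d * (y * Complex.I)) := by
  have hC : 0 ≤ C := by
    have := (norm_nonneg _).trans (hb 0 0 le_rfl le_rfl)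
    exact nonneg_of_mul_nonneg_left this (by positivity)
  -- The factor `(1 + ‖p‖)^r` comes from `1 + ‖u‖ ≤ (1 + ‖p‖)(1 + ‖p + d u‖)`, which transfers the
  -- decay to the rotated variable.
  refine integral_boundary_quadrant (g := fun u => g (p + d * u)) (C := C * (1 + ‖p‖) ^ r) hr ?_ ?_
  · intro x y hx hy
    exact DifferentiableAt.comp (f := fun u => p + d * u) _ (hg x y hx hy) (by fun_prop)
  · intro x y hx hy
    refine (hb x y hx hy).trans ?_
    set u : ℂ := x + y * Complex.I
    have h1 : ‖u‖ ≤ ‖p + d * u‖ + ‖p‖ := by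
      have := norm_sub_le (p + d * u) p
      rwa [add_sub_cancel_left, norm_mul, hd, one_mul] at this
    have h2 : (1 + ‖u‖) ≤ (1 + ‖p‖) * (1 + ‖p + d * u‖) := by
      nlinarith [norm_nonneg p, norm_nonneg (p + d * u)]
    rw [mul_assoc]
    gcongr
    rw [Real.rpow_neg (by positivity), Real.rpow_neg (by positivity), ← div_eq_mul_inv,
      inv_eq_one_div, div_le_div_iff₀ (by positivity) (by positivity), one_mul,
      ← Real.mul_rpow (by positivity) (by positivity)]
    exact Real.rpow_le_rpow (by positivity) h2 (by linarith)

lemma integrable_vertical {g : ℂ → ℂ} {C r c : ℝ} (hr : 1 < r)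
    (hg : ∀ s : ℂ, s.re = c → ContinuousAt g s)
    (hb : ∀ s : ℂ, s.re = c → ‖g s‖ ≤ C * (1 + ‖s‖) ^ (-r)) :
    Integrable (fun t : ℝ => g (c + t * Complex.I)) := by
  have hi := integrableOn_one_add_norm_rpow hr C Set.univ
  rw [integrableOn_univ] at hi
  refine hi.mono' ?_ ?_
  · refine Continuous.aestronglyMeasurable (continuous_iff_continuousAt.2 fun t => ?_)
    exact ContinuousAt.comp (f := fun t : ℝ => (c : ℂ) + t * Complex.I)
      (hg _ (by simp)) (by fun_prop)
  · refine ae_of_all _ fun t => (hb _ (by simp)).trans ?_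
    have hC : 0 ≤ C := by
      have := (norm_nonneg _).trans (hb c (by simp))
      exact nonneg_of_mul_nonneg_left this (by positivity)
    refine mul_le_mul_of_nonneg_left (one_add_norm_rpow_le (by linarith) ?_) hC
    simpa using Complex.abs_im_le_norm (c + t * Complex.I)

/-- A decaying function holomorphic on a right half-plane has integral zero over its edge. -/
theorem integral_vertical_eq_zero {g : ℂ → ℂ} {C r c : ℝ} (hr : 1 < r)
    (hg : ∀ s : ℂ, c ≤ s.re → DifferentiableAt ℂ g s)
    (hb : ∀ s : ℂ, c ≤ s.re → ‖g s‖ ≤ C * (1 + ‖s‖) ^ (-r)) :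
    ∫ t : ℝ, g (c + t * Complex.I) = 0 := by
  -- The half-plane splits into two quadrants with corner `c`. They share the horizontal ray, and
  -- eliminating its integral shows that the two halves of the line cancel.
  have h1 := integral_boundary_rotated_quadrant (g := g) hr c 1 (by simp)
    (fun x y hx hy => hg _ (by simpa using hx)) (fun x y hx hy => hb _ (by simpa using hx))
  have h2 := integral_boundary_rotated_quadrant (g := g) hr c (-Complex.I) (by simp)
    (fun x y hx hy => hg _ (by simpa using hy)) (fun x y hx hy => hb _ (by simpa using hy))
  have hint : Integrable (fun t : ℝ => g (c + t * Complex.I)) :=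
    integrable_vertical hr (fun s hs => (hg s hs.ge).continuousAt) (fun s hs => hb s hs.ge)
  rw [← intervalIntegral.integral_Iic_add_Ioi (b := 0) hint.integrableOn hint.integrableOn,
    setIntegral_Iic_eq_sub]
  simp only [one_mul] at h1
  have e1 : ∀ x : ℝ, (c : ℂ) + -Complex.I * x = c + ((0 - x : ℝ) : ℂ) * Complex.I := by
    intro x; push_cast; ring
  have e2 : ∀ x : ℝ, (c : ℂ) + -Complex.I * (x * Complex.I) = c + x := by
    intro x; linear_combination -(x : ℂ) * Complex.I_mul_I
  simp only [e1, e2] at h2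
  rw [h2, h1]
  linear_combination (∫ y in Set.Ioi (0 : ℝ), g (c + y * Complex.I)) * Complex.I_mul_I

/-- A loop around the left half-line can be opened to a vertical line. -/
theorem loop_eq_vertical {g : ℂ → ℂ} {C r c R : ℝ} (hr : 1 < r)
    (hg : ∀ s : ℂ, (s.re ≤ c ∧ R ≤ |s.im|) ∨ s.re = c → DifferentiableAt ℂ g s)
    (hb : ∀ s : ℂ, (s.re ≤ c ∧ R ≤ |s.im|) ∨ s.re = c → ‖g s‖ ≤ C * (1 + ‖s‖) ^ (-r)) :
    (∫ x in Set.Iic c, g (x - R * Complex.I)) + Complex.I * (∫ t in (-R)..R, g (c + t * Complex.I))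
      - (∫ x in Set.Iic c, g (x + R * Complex.I)) = Complex.I * ∫ t : ℝ, g (c + t * Complex.I) := by
  have m1 : ∀ x y : ℝ, 0 ≤ x → 0 ≤ y →
      (c + R * Complex.I + Complex.I * (x + y * Complex.I) : ℂ).re ≤ c ∧
      R ≤ |(c + R * Complex.I + Complex.I * (x + y * Complex.I) : ℂ).im| := by
    intro x y hx hy
    constructor
    · simpa using hy
    · refine le_trans ?_ (le_abs_self _)
      simpa using hx
  have m2 : ∀ x y : ℝ, 0 ≤ x → 0 ≤ y →
      (c - R * Complex.I + -1 * (x + y * Complex.I) : ℂ).re ≤ c ∧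
      R ≤ |(c - R * Complex.I + -1 * (x + y * Complex.I) : ℂ).im| := by
    intro x y hx hy
    constructor
    · simpa using hx
    · refine le_trans ?_ (neg_le_abs _)
      simpa using hy
  -- Between the loop and the line lie two quadrants, with corners `c + iR` and `c - iR`, both
  -- opening to the left.
  have h1 := integral_boundary_rotated_quadrant (g := g) hr (c + R * Complex.I) Complex.I (by simp)
    (fun x y hx hy => hg _ (.inl (m1 x y hx hy))) (fun x y hx hy => hb _ (.inl (m1 x y hx hy)))
  have h2 := integral_boundary_rotated_quadrant (g := g) hr (c - R * Complex.I) (-1) (by simp)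
    (fun x y hx hy => hg _ (.inl (m2 x y hx hy))) (fun x y hx hy => hb _ (.inl (m2 x y hx hy)))
  have hint : Integrable (fun t : ℝ => g (c + t * Complex.I)) :=
    integrable_vertical hr (fun s hs => (hg s (.inr hs)).continuousAt) (fun s hs => hb s (.inr hs))
  rw [← intervalIntegral.integral_Iic_add_Ioi (b := R) hint.integrableOn hint.integrableOn,
    ← intervalIntegral.integral_Iic_sub_Iic (a := -R) hint.integrableOn hint.integrableOn,
    setIntegral_Iic_eq_sub _ c, setIntegral_Iic_eq_sub _ c, setIntegral_Iic_eq_sub _ (-R),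
    setIntegral_Ioi_eq_add _ R]
  have e1 : ∀ x : ℝ, (c : ℂ) + R * Complex.I + Complex.I * x = c + ((R + x : ℝ) : ℂ) * Complex.I := by
    intro x; push_cast; ring
  have e2 : ∀ x : ℝ, (c : ℂ) + R * Complex.I + Complex.I * (x * Complex.I) =
      ((c - x : ℝ) : ℂ) + R * Complex.I := by
    intro x; push_cast; linear_combination (x : ℂ) * Complex.I_mul_I
  have e3 : ∀ x : ℝ, (c : ℂ) - R * Complex.I + -1 * x = ((c - x : ℝ) : ℂ) - R * Complex.I := by
    intro x; push_cast; ring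
  have e4 : ∀ x : ℝ, (c : ℂ) - R * Complex.I + -1 * (x * Complex.I) =
      c + ((-R - x : ℝ) : ℂ) * Complex.I := by
    intro x; push_cast; ring
  simp only [e1, e2] at h1
  simp only [e3, e4] at h2
  rw [h1, h2]
  linear_combination (-(∫ y in Set.Ioi (0 : ℝ), g (((c - y : ℝ) : ℂ) + R * Complex.I)))
    * Complex.I_mul_I

/-! ### The Mellin transform of the weight: decay and holomorphy -/

/-- The quotient `∏ Γ((j + 1) / n + s) / Γ(β + s) ^ n`, the Mellin transform behind the weight. -/
noncomputable def gammaRatio (n : ℕ) (β : ℝ) (s : ℂ) : ℂ :=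
  (∏ j : Fin n, Complex.Gamma ((((j : ℕ) : ℂ) + 1) / n + s)) / Complex.Gamma (β + s) ^ n

/-- The numerator parameters have mean `(n + 1)/(2n)`. This fixes both the decay exponent of
`gammaRatio` and the threshold for `β`. -/
lemma sum_fin_succ_div {n : ℕ} (hn : 1 ≤ n) :
    ∑ j : Fin n, (((j : ℕ) : ℝ) + 1) / n = ((n : ℝ) + 1) / 2 := by
  have hn0 : (n : ℝ) ≠ 0 := by positivity
  have h : ∀ m : ℕ, ∑ j ∈ Finset.range m, ((j : ℝ) + 1) = m * (m + 1) / 2 := by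
    intro m
    induction m with
    | zero => simp
    | succ m ih => rw [Finset.sum_range_succ, ih]; push_cast; ring
  rw [← Finset.sum_div, Fin.sum_univ_eq_sum_range (fun j : ℕ => (j : ℝ) + 1), h]
  field_simp

/-- The exponents `(j + 1)/n - β` of the `n` factors add up. The constant is uniform for bounded
`β`, which continuity in `β` requires later. -/
theorem exists_norm_gammaRatio_le {n : ℕ} (hn : 1 ≤ n) (B : ℝ) : ∃ C : ℝ, 0 ≤ C ∧
    ∀ β : ℝ, |β| ≤ B → ∀ s ∈ farRegion,
      ‖gammaRatio n β s‖ ≤ C * ‖s‖ ^ (((n : ℝ) + 1) / 2 - n * β) := by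
  obtain ⟨C, hC0, hC⟩ := exists_norm_Gamma_div_le (max B 1)
  refine ⟨C ^ n, by positivity, fun β hβ s hs => ?_⟩
  have hs1 : 0 < ‖s‖ := by linarith [one_le_norm_of_mem_farRegion hs]
  have hn0 : (0 : ℝ) < n := by exact_mod_cast hn
  have h1 : gammaRatio n β s = ∏ j : Fin n, (Complex.Gamma (((((j : ℕ) : ℝ) + 1) / n : ℝ) + s) /
      Complex.Gamma (β + s)) := by
    rw [gammaRatio, Finset.prod_div_distrib]
    simp
  rw [h1, norm_prod]
  calc _ ≤ ∏ j : Fin n, (C * ‖s‖ ^ ((((j : ℕ) : ℝ) + 1) / n - β)) := by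
        refine Finset.prod_le_prod (fun _ _ => norm_nonneg _) fun j _ => ?_
        refine hC β _ (hβ.trans (le_max_left _ _)) (by positivity) ?_ s hs
        refine le_trans ?_ (le_max_right _ _)
        rw [div_le_one hn0]
        exact_mod_cast j.2
    _ = _ := by
        rw [Finset.prod_mul_distrib, ← Real.rpow_sum_of_pos hs1, Finset.sum_sub_distrib,
          sum_fin_succ_div hn]
        simp

lemma differentiableAt_Gamma_shift {n : ℕ} (hn : 1 ≤ n) (j : ℕ) {s : ℂ}
    (hs : -(1 / (n : ℝ)) < s.re ∨ s.im ≠ 0) :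
    DifferentiableAt ℂ (fun s => Complex.Gamma (((j : ℂ) + 1) / n + s)) s := by
  have hn0 : (0 : ℝ) < n := by exact_mod_cast hn
  have e : (((j : ℂ) + 1) / n) = ((((j : ℝ) + 1) / n : ℝ) : ℂ) := by push_cast; rfl
  rw [e]
  refine DifferentiableAt.comp (g := Complex.Gamma) s (Complex.differentiableAt_Gamma _ fun m h => ?_) (by fun_prop)
  rcases hs with hs | hs
  · have h2 := congrArg Complex.re h
    simp only [Complex.add_re, Complex.ofReal_re, Complex.neg_re, Complex.natCast_re] at h2
    have h3 : 1 / (n : ℝ) ≤ ((j : ℝ) + 1) / n := by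
      gcongr
      linarith [(Nat.cast_nonneg j : (0 : ℝ) ≤ j)]
    have : (0 : ℝ) ≤ m := Nat.cast_nonneg m
    linarith
  · have h2 := congrArg Complex.im h
    exact hs (by simpa using h2)

theorem differentiableAt_gammaRatio {n : ℕ} (hn : 1 ≤ n) (β : ℝ) {s : ℂ}
    (hs : -(1 / (n : ℝ)) < s.re ∨ s.im ≠ 0) : DifferentiableAt ℂ (gammaRatio n β) s := by
  have h1 : gammaRatio n β = fun s =>
      (∏ j : Fin n, Complex.Gamma ((((j : ℕ) : ℂ) + 1) / n + s)) *
        ((Complex.Gamma (β + s))⁻¹) ^ n := by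
    ext s; rw [gammaRatio, div_eq_mul_inv, inv_pow]
  rw [h1]
  refine DifferentiableAt.mul ?_ ?_
  · exact DifferentiableAt.fun_finsetProd fun j _ => differentiableAt_Gamma_shift hn j hs
  · exact ((Complex.differentiable_one_div_Gamma.comp (by fun_prop :
      Differentiable ℂ fun s : ℂ => (β : ℂ) + s)) s).pow n

lemma continuous_gammaRatio_param (n : ℕ) (s : ℂ) : Continuous fun β : ℝ => gammaRatio n β s := by
  simp only [gammaRatio, div_eq_mul_inv, ← inv_pow]
  refine continuous_const.mul (Continuous.pow ?_ n)
  exact Complex.differentiable_one_div_Gamma.continuous.comp (by fun_prop)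

lemma gammaRatio_conj (n : ℕ) (β : ℝ) (s : ℂ) :
    gammaRatio n β ((starRingEnd ℂ) s) = (starRingEnd ℂ) (gammaRatio n β s) := by
  simp only [gammaRatio, map_div₀, map_prod, map_pow, ← Complex.Gamma_conj, map_add, map_one,
    Complex.conj_ofReal, Complex.conj_natCast]

lemma isCompact_not_farRegion (c : ℝ) :
    IsCompact (Set.Icc c 1 ×ℂ Set.Icc (-1 : ℝ) 1) := isCompact_Icc.reProdIm isCompact_Icc

/-- Decay of the quotient outside a neighbourhood of its poles. -/
theorem exists_norm_gammaRatio_le_one_add {n : ℕ} (hn : 1 ≤ n) {β c : ℝ}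
    (hc : -(1 / (n : ℝ)) < c) : ∃ C : ℝ, 0 ≤ C ∧
    ∀ s : ℂ, c ≤ s.re ∨ 1 ≤ |s.im| →
      ‖gammaRatio n β s‖ ≤ C * (1 + ‖s‖) ^ (((n : ℝ) + 1) / 2 - n * β) := by
  obtain ⟨C, hC0, hC⟩ := exists_norm_gammaRatio_le hn |β|
  set e := ((n : ℝ) + 1) / 2 - n * β
  have hcont : ContinuousOn (fun s : ℂ => ‖gammaRatio n β s‖ / (1 + ‖s‖) ^ e)
      (Set.Icc c 1 ×ℂ Set.Icc (-1 : ℝ) 1) := by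
    intro s hs
    rw [Complex.mem_reProdIm] at hs
    have h1 := (differentiableAt_gammaRatio hn β (s := s)
      (.inl (hc.trans_le hs.1.1))).continuousAt.norm
    refine (h1.div ?_ (by positivity)).continuousWithinAt
    exact ContinuousAt.rpow_const (by fun_prop) (.inl (by positivity))
  obtain ⟨K, hK⟩ := (isCompact_not_farRegion c).exists_bound_of_continuousOn hcont
  -- In the far region `‖s‖ ≥ 1`, so `‖s‖` and `1 + ‖s‖` differ by at most a factor `2`. The other
  -- admissible `s` lie in a compact rectangle to the right of the poles.
  refine ⟨max K (C * 2 ^ |e|), le_max_of_le_right (by positivity), fun s hs => ?_⟩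
  by_cases hf : s ∈ farRegion
  · have hs1 := one_le_norm_of_mem_farRegion hf
    refine (hC β le_rfl s hf).trans ?_
    have h2 : ‖s‖ ^ e ≤ 2 ^ |e| * (1 + ‖s‖) ^ e := by
      rcases le_total 0 e with he | he
      · have h3 : ‖s‖ ^ e ≤ (1 + ‖s‖) ^ e := Real.rpow_le_rpow (by positivity) (by linarith) he
        have h4 : (1 : ℝ) ≤ 2 ^ |e| := Real.one_le_rpow (by norm_num) (abs_nonneg e)
        nlinarith [Real.rpow_nonneg (by positivity : 0 ≤ 1 + ‖s‖) e]
      · have h3 : (2 * ‖s‖) ^ e ≤ (1 + ‖s‖) ^ e :=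
          Real.rpow_le_rpow_of_nonpos (by positivity) (by linarith) he
        rw [Real.mul_rpow (by norm_num) (by positivity)] at h3
        rw [abs_of_nonpos he, Real.rpow_neg (by norm_num), inv_mul_eq_div, le_div_iff₀ (by positivity)]
        linarith
    calc _ ≤ C * (2 ^ |e| * (1 + ‖s‖) ^ e) := by gcongr
      _ = C * 2 ^ |e| * (1 + ‖s‖) ^ e := by ring
      _ ≤ _ := by gcongr; exact le_max_right _ _
  · have hm : s ∈ Set.Icc c 1 ×ℂ Set.Icc (-1 : ℝ) 1 := by
      simp only [farRegion, Set.mem_ofPred_eq, not_or, not_le] at hf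
      rw [Complex.mem_reProdIm]
      have := abs_lt.1 hf.2
      refine ⟨⟨hs.resolve_right (by linarith [hf.2]), hf.1.le⟩, this.1.le, this.2.le⟩
    have h1 := hK s hm
    rw [Real.norm_eq_abs, abs_of_nonneg (by positivity), div_le_iff₀ (by positivity)] at h1
    refine h1.trans ?_
    gcongr
    exact le_max_left _ _

/-! ### The Meijer function of the weight: vanishing beyond one, reality -/

/-- The Meijer function of the weight, as a function of a real argument. -/
noncomputable def leRoyG (n : ℕ) (β z : ℝ) : ℂ :=
  meijerGq0 (fun _ : Fin n => (β : ℂ)) (fun j : Fin n => (((j : ℕ) : ℂ) + 1) / n) (z : ℂ)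

lemma meijerIntegrand_eq (n : ℕ) (β : ℝ) (z s : ℂ) :
    meijerIntegrand (fun _ : Fin n => (β : ℂ)) (fun j : Fin n => (((j : ℕ) : ℂ) + 1) / n) z s =
      z ^ (-s) * gammaRatio n β s := by
  simp [meijerIntegrand, gammaRatio, mul_div_assoc]

lemma loopRadius_eq {n : ℕ} (hn : 1 ≤ n) :
    1 + ∑ j : Fin n, ‖(((j : ℕ) : ℂ) + 1) / n‖ = 1 + ((n : ℝ) + 1) / 2 := by
  rw [← sum_fin_succ_div hn]
  congr 1
  refine Finset.sum_congr rfl fun j _ => ?_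
  rw [norm_div, Complex.norm_natCast]
  congr 1
  rw [show ((j : ℕ) : ℂ) + 1 = (((j : ℕ) + 1 : ℕ) : ℂ) by push_cast; rfl, Complex.norm_natCast]
  push_cast; rfl

lemma leRoyG_of_lt_one {n : ℕ} (hn : 1 ≤ n) (β : ℝ) {z : ℝ} (hz0 : 0 ≤ z) (hz : z < 1) :
    leRoyG n β z = (2 * Real.pi * Complex.I)⁻¹ *
      leftLoopIntegral (fun s => (z : ℂ) ^ (-s) * gammaRatio n β s) (1 + ((n : ℝ) + 1) / 2) := by
  have : ‖(z : ℂ)‖ < 1 := by rwa [Complex.norm_real, Real.norm_of_nonneg hz0]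
  simp only [leRoyG, meijerGq0, loopRadius_eq hn]
  rw [if_pos (.inr ⟨trivial, this⟩)]
  simp only [funext (meijerIntegrand_eq n β z)]

lemma leRoyG_of_one_le {n : ℕ} (hn : 1 ≤ n) (β : ℝ) {z : ℝ} (hz : 1 ≤ z) :
    leRoyG n β z = (2 * Real.pi * Complex.I)⁻¹ *
      rightLoopIntegral (fun s => (z : ℂ) ^ (-s) * gammaRatio n β s) (1 + ((n : ℝ) + 1) / 2) := by
  have : ¬ ‖(z : ℂ)‖ < 1 := by
    rw [Complex.norm_real, Real.norm_of_nonneg (by linarith)]; exact not_lt.2 hz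
  simp only [leRoyG, meijerGq0, loopRadius_eq hn]
  rw [if_neg (by simpa using this)]
  simp only [funext (meijerIntegrand_eq n β z)]

lemma differentiableAt_integrand {n : ℕ} (hn : 1 ≤ n) (β : ℝ) {z : ℝ} (hz : 0 < z) {s : ℂ}
    (hs : -(1 / (n : ℝ)) < s.re ∨ s.im ≠ 0) :
    DifferentiableAt ℂ (fun s => (z : ℂ) ^ (-s) * gammaRatio n β s) s := by
  have hz' : (z : ℂ) ≠ 0 := by exact_mod_cast hz.ne'
  exact ((differentiableAt_id.neg).const_cpow (.inl hz')).mul (differentiableAt_gammaRatio hn β hs)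

/-- The poles are to the left of the loop, and for `z > 1` the exponential decay of `z^(-x)` beats
the power growth of `gammaRatio`. Cauchy's theorem on the half-strip inside the loop therefore gives
zero, with no restriction on `β`. -/
theorem leRoyG_eq_zero {n : ℕ} (hn : 1 ≤ n) (β : ℝ) {z : ℝ} (hz : 1 < z) : leRoyG n β z = 0 := by
  have hz0 : 0 < z := by linarith
  have hn0 : (0 : ℝ) < n := by exact_mod_cast hn
  rw [leRoyG_of_one_le hn β hz.le]
  set R := 1 + ((n : ℝ) + 1) / 2
  have hR : 1 ≤ R := by simp only [R]; linarith
  obtain ⟨C, hC0, hC⟩ := exists_norm_gammaRatio_le hn |β|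
  set e := ((n : ℝ) + 1) / 2 - n * β
  have hlog := Real.log_pos hz
  have h := integral_boundary_halfStrip (g := fun s => (z : ℂ) ^ (-s) * gammaRatio n β s) (a := R)
    (p := -R) (q := R) (by linarith)
    (B := fun x => C * 2 ^ |e| * (x ^ |e| * Real.exp (-Real.log z * x))) ?_ ?_ ?_ ?_
  · rw [rightLoopIntegral, integral_Ici_eq_integral_Ioi, integral_Ici_eq_integral_Ioi]
    simp only [Complex.ofReal_neg, neg_mul, ← sub_eq_add_neg] at h
    rw [← h]
    ring
  · intro x y hx _
    refine differentiableAt_integrand hn β hz0 (.inl ?_)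
    have : 0 < 1 / (n : ℝ) := by positivity
    simp only [Complex.add_re, Complex.ofReal_re, Complex.mul_re, Complex.I_re, mul_zero,
      Complex.ofReal_im, Complex.I_im, mul_one, sub_self, add_zero]
    linarith
  · intro x y hx hy
    have hf : (x + y * Complex.I : ℂ) ∈ farRegion := .inl (by simpa using hR.trans hx)
    have h1 := one_le_norm_of_mem_farRegion hf
    rw [norm_mul, Complex.norm_cpow_eq_rpow_re_of_pos hz0]
    have h2 : (-(x + y * Complex.I : ℂ)).re = -x := by simp
    -- On this half-strip `|y| ≤ R ≤ x`; this is the source of the factor `2 ^ |e|` in the majorant.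
    have h3 : ‖(x + y * Complex.I : ℂ)‖ ≤ 2 * x := by
      refine (norm_add_le _ _).trans ?_
      rw [norm_mul, Complex.norm_I, Complex.norm_real, Complex.norm_real, Real.norm_eq_abs,
        Real.norm_eq_abs, abs_of_nonneg (by linarith)]
      have := abs_le.2 hy
      linarith
    have h4 : ‖gammaRatio n β (x + y * Complex.I)‖ ≤ C * (2 ^ |e| * x ^ |e|) := by
      refine (hC β le_rfl _ hf).trans ?_
      rw [← Real.mul_rpow (by norm_num) (by linarith)]
      refine mul_le_mul_of_nonneg_left ?_ hC0
      exact (Real.rpow_le_rpow_of_exponent_le h1 (le_abs_self e)).trans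
        (Real.rpow_le_rpow (by positivity) h3 (abs_nonneg e))
    rw [h2, Real.rpow_def_of_pos hz0, mul_neg, ← neg_mul]
    calc _ ≤ Real.exp (-Real.log z * x) * (C * (2 ^ |e| * x ^ |e|)) := by gcongr
      _ = _ := by ring
  · have := integrableOn_rpow_mul_exp_neg_mul_rpow (p := 1) (s := |e|) (b := Real.log z)
      (by linarith [abs_nonneg e]) one_pos hlog
    simp only [Real.rpow_one] at this
    exact (this.mono_set (Set.Ioi_subset_Ioi (by linarith))).const_mul _
  · simpa using (tendsto_rpow_mul_exp_neg_mul_atTop_nhds_zero |e| (Real.log z) hlog).const_mul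
      (C * 2 ^ |e|)

/-- Conjugation exchanges the two horizontal rays and reflects the vertical segment, so the loop
integral is purely imaginary. After division by `2πi` the value is real, and taking the real part in
the weight loses nothing. -/
lemma conj_leftLoopIntegral {f : ℂ → ℂ} (hf : ∀ s, f ((starRingEnd ℂ) s) = (starRingEnd ℂ) (f s))
    (R : ℝ) : (starRingEnd ℂ) (leftLoopIntegral f R) = -leftLoopIntegral f R := by
  have h1 : ∀ x : ℝ, (starRingEnd ℂ) (f (x - R * Complex.I)) = f (x + R * Complex.I) := by
    intro x; rw [← hf]; simp
  have h2 : ∀ x : ℝ, (starRingEnd ℂ) (f (x + R * Complex.I)) = f (x - R * Complex.I) := by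
    intro x; rw [← hf]; simp [sub_eq_add_neg]
  have h3 : (starRingEnd ℂ) (∫ t in (-R)..R, f (R + t * Complex.I)) =
      ∫ t in (-R)..R, f (R + t * Complex.I) := by
    have h4 : ∀ t : ℝ, (starRingEnd ℂ) (f (R + t * Complex.I)) = f (R + (-t : ℝ) * Complex.I) := by
      intro t; rw [← hf]; simp
    rw [intervalIntegral, map_sub, ← integral_conj, ← integral_conj]
    simp only [h4]
    have h5 := intervalIntegral.integral_comp_neg (a := -R) (b := R)
      (fun t : ℝ => f (R + t * Complex.I))
    rw [neg_neg] at h5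
    exact h5
  simp only [leftLoopIntegral, map_sub, map_add, map_mul, h3, ← integral_conj, h1, h2, Complex.conj_I]
  ring

theorem conj_leRoyG {n : ℕ} (hn : 1 ≤ n) (β : ℝ) {z : ℝ} (hz0 : 0 < z) (hz : z < 1) :
    (starRingEnd ℂ) (leRoyG n β z) = leRoyG n β z := by
  rw [leRoyG_of_lt_one hn β hz0.le hz, map_mul, conj_leftLoopIntegral]
  · simp only [map_inv₀, map_mul, Complex.conj_I, Complex.conj_ofReal, map_ofNat]
    rw [mul_neg (2 * (Real.pi : ℂ)), inv_neg, neg_mul_neg]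
  · intro s
    rw [map_mul, gammaRatio_conj, ← map_neg, Complex.cpow_conj, Complex.conj_ofReal]
    rw [Complex.arg_ofReal_of_nonneg hz0.le]
    exact Real.pi_pos.ne

lemma leRoyWeight_of_pos (n : ℕ) (β : ℝ) {y : ℝ} (hy : 0 < y) :
    leRoyWeight 1 n n β y = (2 * Real.pi) ^ ((1 - (n : ℝ)) / 2) * (n : ℝ) ^ (3 / 2 : ℝ) / y *
      (leRoyG n β (y ^ n / (n : ℝ) ^ n)).re := by
  have h1 : (fun i : Fin n × Fin 1 => deltaSeq 1 β i.2) = fun _ => (β : ℂ) := by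
    ext i; simp [deltaSeq]
  have h2 : deltaSeq n 1 = fun j : Fin n => (((j : ℕ) : ℂ) + 1) / n := by
    ext j; simp [deltaSeq, add_comm]
  have h3 : ∀ (b : Fin n → ℂ) (z : ℂ), meijerGq0 (fun _ : Fin n × Fin 1 => (β : ℂ)) b z =
      meijerGq0 (fun _ : Fin n => (β : ℂ)) b z := by
    intro b z
    have : meijerIntegrand (fun _ : Fin n × Fin 1 => (β : ℂ)) b z =
        meijerIntegrand (fun _ : Fin n => (β : ℂ)) b z := by
      ext s; simp [meijerIntegrand]
    simp [meijerGq0, this]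
  rw [leRoyWeight, if_pos hy, h1, h2, h3, leRoyG]
  simp only [Nat.cast_one, one_pow, one_mul, Real.one_rpow, div_one, sub_self, mul_zero, zero_div,
    sub_zero]
  ring

lemma leRoyWeight_of_nonpos (n : ℕ) (β : ℝ) {y : ℝ} (hy : y ≤ 0) : leRoyWeight 1 n n β y = 0 :=
  if_neg (not_lt.2 hy)

lemma leRoyWeight_eq_zero_of_lt {n : ℕ} (hn : 1 ≤ n) (β : ℝ) {y : ℝ} (hy : (n : ℝ) < y) :
    leRoyWeight 1 n n β y = 0 := by
  have hn0 : (0 : ℝ) < n := by exact_mod_cast hn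
  rw [leRoyWeight_of_pos n β (by linarith), leRoyG_eq_zero hn, Complex.zero_re, mul_zero]
  rw [one_lt_div (by positivity)]
  exact pow_lt_pow_left₀ hy hn0.le (by lia)

theorem support_leRoyWeight_subset {n : ℕ} (hn : 1 ≤ n) (β : ℝ) :
    Function.support (leRoyWeight 1 n n β) ⊆ Set.Icc (0 : ℝ) n := by
  intro y hy
  by_contra h
  rw [Set.mem_Icc, not_and_or, not_le, not_le] at h
  rcases h with h | h
  · exact hy (leRoyWeight_of_nonpos n β h.le)
  · exact hy (leRoyWeight_eq_zero_of_lt hn β h)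

lemma pow_div_pow_lt_one {n : ℕ} (hn : 1 ≤ n) {y : ℝ} (hy : 0 < y) (hyn : y < n) :
    y ^ n / (n : ℝ) ^ n < 1 := by
  have hn0 : (0 : ℝ) < n := by exact_mod_cast hn
  rw [div_lt_one (by positivity)]
  exact pow_lt_pow_left₀ hyn hy.le (by lia)

theorem leRoyWeight_eq_meijer {n : ℕ} (hn : 1 ≤ n) (β : ℝ) {y : ℝ} (hy : 0 < y) (hyn : y ≠ n) :
    (leRoyWeight 1 n n β y : ℂ) =
      (((2 * Real.pi) ^ ((1 - (n : ℝ)) / 2) * (n : ℝ) ^ (3 / 2 : ℝ) / y : ℝ) : ℂ)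
        * leRoyG n β (y ^ n / (n : ℝ) ^ n) * (if y < n then 1 else 0) := by
  have hn0 : (0 : ℝ) < n := by exact_mod_cast hn
  rcases lt_or_gt_of_ne hyn with h | h
  · rw [if_pos h, mul_one, leRoyWeight_of_pos n β hy, Complex.ofReal_mul]
    congr 1
    exact Complex.conj_eq_iff_re.1 (conj_leRoyG hn β (by positivity) (pow_div_pow_lt_one hn hy h))
  · rw [leRoyWeight_eq_zero_of_lt hn β h, if_neg (by linarith)]
    simp

/-! ### Cauchy's integral formula on a half-plane -/

lemma one_add_norm_le_mul_norm_sub {q : ℝ} (hq : 0 < q) {a s : ℂ} (h : q ≤ ‖s - a‖) :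
    1 + ‖s‖ ≤ ((1 + ‖a‖) / q + 1) * ‖s - a‖ := by
  have h1 : ‖s‖ ≤ ‖s - a‖ + ‖a‖ := by simpa using norm_add_le (s - a) a
  have h2 : (1 + ‖a‖) ≤ (1 + ‖a‖) / q * ‖s - a‖ := by
    rw [div_mul_eq_mul_div, le_div_iff₀ hq]; gcongr
  linarith

/-- Division by `s - a`, away from `a`, gains one power of decay. Any positive decay of the
numerator then becomes an exponent larger than one, as the contour theorems require. -/
lemma norm_div_sub_le {q C r : ℝ} (hq : 0 < q) {a s x : ℂ} (h : q ≤ ‖s - a‖)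
    (hx : ‖x‖ ≤ C * (1 + ‖s‖) ^ (-r)) :
    ‖x / (s - a)‖ ≤ C * ((1 + ‖a‖) / q + 1) * (1 + ‖s‖) ^ (-(1 + r)) := by
  have h1 := one_add_norm_le_mul_norm_sub hq h
  have h2 : 0 < ‖s - a‖ := hq.trans_le h
  have h3 : (1 + ‖s‖) ^ (-(1 + r)) = (1 + ‖s‖) ^ (-r) / (1 + ‖s‖) := by
    rw [← Real.rpow_sub_one (by positivity)]; congr 1; ring
  have h4 : 0 ≤ C * (1 + ‖s‖) ^ (-r) := (norm_nonneg _).trans hx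
  rw [norm_div, h3, div_le_iff₀ h2]
  calc ‖x‖ ≤ C * (1 + ‖s‖) ^ (-r) := hx
    _ = C * (1 + ‖s‖) ^ (-r) * ((1 + ‖s‖) / (1 + ‖s‖)) := by field_simp
    _ ≤ C * (1 + ‖s‖) ^ (-r) * ((((1 + ‖a‖) / q + 1) * ‖s - a‖) / (1 + ‖s‖)) := by gcongr
    _ = _ := by ring

lemma integral_two_mul_div_add_mul_sub {q : ℝ} (hq : 0 < q) :
    ∫ t : ℝ, (2 * q / ((q + t * Complex.I) * (q - t * Complex.I)) : ℂ) = 2 * Real.pi := by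
  have h1 : ∀ t : ℝ, (2 * q / ((q + t * Complex.I) * (q - t * Complex.I)) : ℂ) =
      ((2 / q * (1 + (t / q) ^ 2)⁻¹ : ℝ) : ℂ) := by
    intro t
    have h2 : ((q + t * Complex.I) * (q - t * Complex.I) : ℂ) = ((q ^ 2 + t ^ 2 : ℝ) : ℂ) := by
      push_cast; linear_combination -(t : ℂ) ^ 2 * Complex.I_sq
    rw [h2]
    norm_cast
    have : q ^ 2 + t ^ 2 ≠ 0 := by positivity
    field_simp
  simp only [h1]
  rw [integral_complex_ofReal, integral_const_mul,
    Measure.integral_comp_div (fun t : ℝ => (1 + t ^ 2)⁻¹), integral_univ_inv_one_add_sq,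
    abs_of_pos hq]
  push_cast
  have : (q : ℂ) ≠ 0 := by exact_mod_cast hq.ne'
  field_simp
  simp

/-- Cauchy's integral formula on a right half-plane, for functions of positive decay. -/
theorem integral_vertical_div_sub {M : ℂ → ℂ} {C δ c w : ℝ} (hδ : 0 < δ) (hcw : c < w)
    (hM : ∀ s : ℂ, c ≤ s.re → DifferentiableAt ℂ M s)
    (hb : ∀ s : ℂ, c ≤ s.re → ‖M s‖ ≤ C * (1 + ‖s‖) ^ (-δ)) :
    ∫ t : ℝ, M (c + t * Complex.I) / (w - (c + t * Complex.I)) = 2 * Real.pi * M w := by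
  set q := w - c with hq
  have hq0 : 0 < q := by linarith
  set A := q - c with hA
  -- The auxiliary function below decays only as fast as the slower of `M` and a simple fraction.
  set δ' := min δ 1
  have hδ' : 0 < δ' := lt_min hδ one_pos
  have hC0 : 0 ≤ C := by
    have := (norm_nonneg _).trans (hb c (by simp))
    exact nonneg_of_mul_nonneg_left this (by positivity)
  have hmono : ∀ (s : ℂ) (d : ℝ), δ' ≤ d → (1 + ‖s‖) ^ (-d) ≤ (1 + ‖s‖) ^ (-δ') := fun s d hd =>
    Real.rpow_le_rpow_of_exponent_le (by linarith [norm_nonneg s]) (by linarith)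
  have hne : ∀ s : ℂ, c ≤ s.re → q ≤ ‖s - ((-A : ℝ) : ℂ)‖ := by
    intro s hs
    refine le_trans ?_ ((le_abs_self _).trans (Complex.abs_re_le_norm _))
    simp only [Complex.sub_re, Complex.ofReal_re]
    linarith
  have hne' : ∀ s : ℂ, c ≤ s.re → s - ((-A : ℝ) : ℂ) ≠ 0 := fun s hs h => by
    have := hne s hs
    rw [h, norm_zero] at this
    linarith
  -- The subtracted fraction has its pole at `-A = c - q`, the mirror image of `w = c + q` in the
  -- line `Re s = c`, and agrees with `M` at `w`. Thus `N(s)/(s - w)` extends holomorphically to the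
  -- half-plane with decay larger than one and integrates to zero; only an explicit rational
  -- integral remains.
  set N : ℂ → ℂ := fun s => M s - M w * (2 * q) / (s - ((-A : ℝ) : ℂ)) with hN
  have hNw : N w = 0 := by
    have : (w : ℂ) - ((-A : ℝ) : ℂ) = 2 * q := by
      rw [hA, hq]; push_cast; ring
    have h2 : (2 * q : ℂ) ≠ 0 := by simpa using hq0.ne'
    simp only [hN]
    rw [this, mul_div_assoc, div_self h2, mul_one, sub_self]
  have hNd : ∀ s : ℂ, c ≤ s.re → DifferentiableAt ℂ N s := fun s hs =>
    (hM s hs).sub ((differentiableAt_const _).div (by fun_prop) (hne' s hs))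
  obtain ⟨K, hK0, hK⟩ : ∃ K, 0 ≤ K ∧ ∀ s : ℂ, c ≤ s.re → ‖N s‖ ≤ K * (1 + ‖s‖) ^ (-δ') := by
    refine ⟨C + ‖M w * (2 * q)‖ * ((1 + ‖((-A : ℝ) : ℂ)‖) / q + 1), by positivity, fun s hs => ?_⟩
    have h1 : ‖M s‖ ≤ C * (1 + ‖s‖) ^ (-δ') := (hb s hs).trans (by
      have := hmono s δ (min_le_left _ _)
      exact mul_le_mul_of_nonneg_left this hC0)
    have h2 := norm_div_sub_le (C := ‖M w * (2 * q)‖) (r := 0) (x := M w * (2 * q)) hq0 (hne s hs)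
      (by simp)
    rw [add_zero] at h2
    have h3 := hmono s 1 (min_le_right _ _)
    refine (norm_sub_le _ _).trans ?_
    rw [add_mul]
    refine add_le_add h1 (h2.trans ?_)
    exact mul_le_mul_of_nonneg_left h3 (by positivity)
  have hdd : ∀ s : ℂ, c ≤ s.re → DifferentiableAt ℂ (dslope N w) s := by
    intro s hs
    rcases eq_or_ne s w with rfl | hsw
    · have hU : {s : ℂ | c < s.re} ∈ 𝓝 (w : ℂ) :=
        (isOpen_lt continuous_const Complex.continuous_re).mem_nhds (by simpa using hcw)
      exact ((Complex.differentiableOn_dslope hU).2 fun s hs =>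
        (hNd s (le_of_lt hs)).differentiableWithinAt).differentiableAt hU
    · exact (differentiableAt_dslope_of_ne hsw).2 (hNd s hs)
  obtain ⟨K', hK'⟩ : ∃ K', ∀ s : ℂ, c ≤ s.re → ‖dslope N w s‖ ≤ K' * (1 + ‖s‖) ^ (-(1 + δ')) := by
    have hcomp : IsCompact (Metric.closedBall (w : ℂ) 1 ∩ {s : ℂ | c ≤ s.re}) :=
      (isCompact_closedBall _ _).inter_right (isClosed_le continuous_const Complex.continuous_re)
    have hcont : ContinuousOn (fun s : ℂ => ‖dslope N w s‖ / (1 + ‖s‖) ^ (-(1 + δ')))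
        (Metric.closedBall (w : ℂ) 1 ∩ {s : ℂ | c ≤ s.re}) := by
      intro s hs
      refine ((hdd s hs.2).continuousAt.norm.div ?_ (by positivity)).continuousWithinAt
      exact ContinuousAt.rpow_const (by fun_prop) (.inl (by positivity))
    obtain ⟨D, hD⟩ := hcomp.exists_bound_of_continuousOn hcont
    refine ⟨max D (K * ((1 + ‖(w : ℂ)‖) / 1 + 1)), fun s hs => ?_⟩
    rcases le_or_gt ‖s - w‖ 1 with h | h
    · have := hD s ⟨by simpa [dist_eq_norm] using h, hs⟩
      rw [Real.norm_eq_abs, abs_of_nonneg (by positivity), div_le_iff₀ (by positivity)] at this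
      refine this.trans (mul_le_mul_of_nonneg_right (le_max_left _ _) (by positivity))
    · have hsw : s ≠ w := by
        rintro rfl
        simp at h
        linarith
      rw [dslope_of_ne _ hsw, slope_def_field, hNw, sub_zero]
      refine (norm_div_sub_le one_pos h.le (hK s hs)).trans ?_
      exact mul_le_mul_of_nonneg_right (le_max_right _ _) (by positivity)
  have hzero := integral_vertical_eq_zero (by linarith) hdd hK'
  have hlt : ∀ s : ℂ, s.re = c → q ≤ ‖s - w‖ := by
    intro s hs
    refine le_trans ?_ ((neg_le_abs _).trans (Complex.abs_re_le_norm _))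
    simp only [Complex.sub_re, Complex.ofReal_re, hs]
    linarith
  have hlt' : ∀ s : ℂ, s.re = c → s - w ≠ 0 := fun s hs h => by
    have := hlt s hs
    rw [h, norm_zero] at this
    linarith
  have i1 : Integrable (fun t : ℝ => M (c + t * Complex.I) / ((c + t * Complex.I) - w)) :=
    integrable_vertical (g := fun s => M s / (s - w)) (r := 1 + δ) (by linarith)
      (fun s hs => (hM s hs.ge).continuousAt.div (by fun_prop) (hlt' s hs))
      (fun s hs => norm_div_sub_le hq0 (hlt s hs) (hb s hs.ge))
  have i2 : Integrable (fun t : ℝ => dslope N w (c + t * Complex.I)) :=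
    integrable_vertical (r := 1 + δ') (by linarith) (fun s hs => (hdd s hs.ge).continuousAt)
      (fun s hs => hK' s hs.ge)
  have key : ∀ t : ℝ, M (c + t * Complex.I) / (w - (c + t * Complex.I)) =
      M w * (2 * q / ((q + t * Complex.I) * (q - t * Complex.I))) -
        dslope N w (c + t * Complex.I) := by
    intro t
    have h1 : (c + t * Complex.I : ℂ) - w ≠ 0 := hlt' _ (by simp)
    have h1' : (q - t * Complex.I : ℂ) ≠ 0 := by
      intro h; apply h1; rw [hq] at h; push_cast at h; linear_combination -h
    have h2 := hne' (c + t * Complex.I) (by simp)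
    have h2' : (q + t * Complex.I : ℂ) ≠ 0 := by
      intro h; apply h2; rw [hA]; push_cast; linear_combination h
    rw [dslope_of_ne _ (sub_ne_zero.1 h1), slope_def_field, hNw, sub_zero]
    simp only [hN]
    rw [show (c + t * Complex.I : ℂ) - ((-A : ℝ) : ℂ) = q + t * Complex.I by
        rw [hA]; push_cast; ring,
      show (c + t * Complex.I : ℂ) - w = -(q - t * Complex.I) by rw [hq]; push_cast; ring,
      show (w : ℂ) - (c + t * Complex.I) = q - t * Complex.I by rw [hq]; push_cast; ring]
    field_simp
    ring
  have i3 : Integrable (fun t : ℝ =>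
      M w * (2 * q / ((q + t * Complex.I) * (q - t * Complex.I)) : ℂ)) := by
    -- The rational term is the combination of the two functions already known to be integrable.
    refine (i2.sub i1).congr (ae_of_all _ fun t => ?_)
    have := key t
    rw [show (w : ℂ) - (c + t * Complex.I) = -((c + t * Complex.I) - w) by ring, div_neg] at this
    simp only [Pi.sub_apply]
    linear_combination this
  simp only [key]
  rw [integral_sub i3 i2, hzero, sub_zero, integral_const_mul, integral_two_mul_div_add_mul_sub hq0]
  ring

/-! ### Integrating powers under the contour integral -/

lemma integral_Ioo_rpow_sub_one {a : ℝ} (ha : 0 < a) :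
    IntegrableOn (fun v : ℝ => v ^ (a - 1)) (Set.Ioo 0 1) ∧
      ∫ v in Set.Ioo (0 : ℝ) 1, v ^ (a - 1) = 1 / a := by
  constructor
  · have := (intervalIntegral.intervalIntegrable_rpow' (a := 0) (b := 1) (r := a - 1) (by linarith)).1
    exact this.mono_set Set.Ioo_subset_Ioc_self
  · rw [← integral_Ioc_eq_integral_Ioo, ← intervalIntegral.integral_of_le zero_le_one,
      integral_rpow (.inl (by linarith))]
    simp [Real.zero_rpow ha.ne']

lemma integral_Ioo_cpow_sub_one {a : ℂ} (ha : 0 < a.re) :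
    ∫ v in Set.Ioo (0 : ℝ) 1, (v : ℂ) ^ (a - 1) = 1 / a := by
  rw [← integral_Ioc_eq_integral_Ioo, ← intervalIntegral.integral_of_le zero_le_one,
    integral_cpow (.inl (by simpa using ha))]
  have : a ≠ 0 := by rintro rfl; simp at ha
  simp [Complex.zero_cpow this]

/-- Integrating a superposition of powers over `(0, 1)`. -/
theorem integral_Ioo_integral_cpow {μ : Measure ℝ} [SFinite μ] {γ m : ℝ → ℂ} (hγ : Measurable γ)
    (hm : AEStronglyMeasurable m μ) (h0 : ∀ᵐ t ∂μ, 0 < (γ t).re)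
    (hint : Integrable (fun t => ‖m t‖ / (γ t).re) μ) :
    IntegrableOn (fun v : ℝ => ∫ t, (v : ℂ) ^ (γ t - 1) * m t ∂μ) (Set.Ioo 0 1) ∧
      ∫ v in Set.Ioo (0 : ℝ) 1, ∫ t, (v : ℂ) ^ (γ t - 1) * m t ∂μ = ∫ t, m t / γ t ∂μ := by
  have hmeas : Measurable fun p : ℝ × ℝ => (p.1 : ℂ) ^ (γ p.2 - 1) :=
    (Complex.measurable_ofReal.comp measurable_fst).pow
      ((hγ.comp measurable_snd).sub_const 1)
  have hnorm : ∀ t : ℝ, ∀ᵐ v : ℝ ∂(volume.restrict (Set.Ioo (0 : ℝ) 1)),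
      v ^ ((γ t).re - 1) * ‖m t‖ = ‖(v : ℂ) ^ (γ t - 1) * m t‖ := by
    intro t
    filter_upwards [ae_restrict_mem measurableSet_Ioo] with v hv
    rw [norm_mul, Complex.norm_cpow_eq_rpow_re_of_pos hv.1]
    simp
  have hprod : Integrable (Function.uncurry fun (v t : ℝ) => (v : ℂ) ^ (γ t - 1) * m t)
      ((volume.restrict (Set.Ioo (0 : ℝ) 1)).prod μ) := by
    have hsm : AEStronglyMeasurable (Function.uncurry fun (v t : ℝ) => (v : ℂ) ^ (γ t - 1) * m t)
        ((volume.restrict (Set.Ioo (0 : ℝ) 1)).prod μ) :=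
      hmeas.aestronglyMeasurable.mul hm.comp_snd
    rw [integrable_prod_iff' hsm]
    constructor
    · filter_upwards [h0] with t ht
      have h1 := (integral_Ioo_rpow_sub_one ht).1.mul_const ‖m t‖
      have h2 : AEStronglyMeasurable (fun v : ℝ => (v : ℂ) ^ (γ t - 1) * m t)
          (volume.restrict (Set.Ioo (0 : ℝ) 1)) :=
        ((hmeas.comp (measurable_id.prodMk measurable_const)).mul_const _).aestronglyMeasurable
      exact (integrable_norm_iff h2).1 (h1.congr (hnorm t))
    · refine hint.congr ?_
      filter_upwards [h0] with t ht
      simp only [Function.uncurry]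
      rw [← integral_congr_ae (hnorm t), integral_mul_const, (integral_Ioo_rpow_sub_one ht).2]
      ring
  refine ⟨hprod.integral_prod_left, ?_⟩
  rw [integral_integral_swap hprod]
  refine integral_congr_ae ?_
  filter_upwards [h0] with t ht
  rw [integral_mul_const, integral_Ioo_cpow_sub_one ht]
  ring

/-- Integral along the loop which comes from `-∞ - iR`, runs through `c - iR` and `c + iR`, and
goes back to `-∞ + iR`. -/
noncomputable def shiftedLoopIntegral (f : ℂ → ℂ) (c R : ℝ) : ℂ :=
  (∫ x in Set.Iic c, f (x - R * Complex.I)) + Complex.I * (∫ t in (-R)..R, f (c + t * Complex.I))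
    - ∫ x in Set.Iic c, f (x + R * Complex.I)

/-- The vertical side moves from `R` to `c` across a region free of poles. A contour in `Re s < 0`
is needed so that `v^(r - ns - 1)` is integrable at `0` for every `r ≥ 0`. -/
lemma leftLoopIntegral_eq_shiftedLoopIntegral {f : ℂ → ℂ} {c R : ℝ} (hcR : c ≤ R)
    (hf : ∀ s : ℂ, c ≤ s.re → DifferentiableAt ℂ f s)
    (h1 : IntegrableOn (fun x : ℝ => f (x - R * Complex.I)) (Set.Iic R))
    (h2 : IntegrableOn (fun x : ℝ => f (x + R * Complex.I)) (Set.Iic R)) :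
    leftLoopIntegral f R = shiftedLoopIntegral f c R := by
  have hr := Complex.integral_boundary_rect_eq_zero_of_differentiableOn f
    (c + (-R : ℝ) * Complex.I) (R + R * Complex.I) ?_
  · simp only [Complex.add_re, Complex.ofReal_re, Complex.mul_re, Complex.I_re, mul_zero,
      Complex.ofReal_im, Complex.I_im, mul_one, sub_self, add_zero, Complex.add_im,
      Complex.mul_im, zero_add, smul_eq_mul] at hr
    have e1 := intervalIntegral.integral_Iic_sub_Iic
      (h1.mono_set (Set.Iic_subset_Iic.2 hcR)) h1
    have e2 := intervalIntegral.integral_Iic_sub_Iic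
      (h2.mono_set (Set.Iic_subset_Iic.2 hcR)) h2
    simp only [Complex.ofReal_neg, neg_mul, ← sub_eq_add_neg] at hr
    rw [leftLoopIntegral, shiftedLoopIntegral]
    linear_combination hr + e1 - e2
  · intro s hs
    rw [Complex.mem_reProdIm] at hs
    simp only [Complex.add_re, Complex.ofReal_re, Complex.mul_re, Complex.I_re, mul_zero,
      Complex.ofReal_im, Complex.I_im, mul_one, sub_self, add_zero, Set.uIcc_of_le hcR] at hs
    exact (hf s hs.1.1).differentiableWithinAt

lemma integrableOn_Iic_rpow_neg {z : ℝ} (hz0 : 0 < z) (hz : z < 1) (R : ℝ) :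
    IntegrableOn (fun x : ℝ => z ^ (-x)) (Set.Iic R) := by
  have h := integrableOn_exp_mul_Iic (a := -Real.log z) (by linarith [Real.log_neg hz0 hz]) R
  refine h.congr_fun (fun x _ => ?_) measurableSet_Iic
  simp only
  rw [Real.rpow_def_of_pos hz0]
  ring_nf

lemma integrableOn_Iic_integrand {n : ℕ} (hn : 1 ≤ n) {β : ℝ} (hβ : ((n : ℝ) + 1) / (2 * n) ≤ β)
    {z : ℝ} (hz0 : 0 < z) (hz : z < 1) {R : ℝ} (a : ℝ) (hR : 1 ≤ |R|) :
    IntegrableOn (fun x : ℝ => (z : ℂ) ^ (-(x + R * Complex.I)) *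
      gammaRatio n β (x + R * Complex.I)) (Set.Iic a) := by
  have hn0 : (0 : ℝ) < n := by exact_mod_cast hn
  obtain ⟨C, hC0, hC⟩ := exists_norm_gammaRatio_le hn |β|
  refine Integrable.mono' ((integrableOn_Iic_rpow_neg hz0 hz a).mul_const C) ?_ ?_
  · refine (Continuous.aestronglyMeasurable (continuous_iff_continuousAt.2 fun x => ?_))
    refine ContinuousAt.comp (f := fun x : ℝ => (x : ℂ) + R * Complex.I)
      (differentiableAt_integrand hn β hz0 (.inr ?_)).continuousAt (by fun_prop)
    have : R ≠ 0 := by rintro rfl; norm_num at hR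
    simpa using this
  · refine ae_of_all _ fun x => ?_
    have hf : (x + R * Complex.I : ℂ) ∈ farRegion := .inr (by simpa using hR)
    rw [norm_mul, Complex.norm_cpow_eq_rpow_re_of_pos hz0]
    have h1 : (-(x + R * Complex.I : ℂ)).re = -x := by simp
    rw [h1]
    refine mul_le_mul_of_nonneg_left ((hC β le_rfl _ hf).trans ?_) (by positivity)
    refine mul_le_of_le_one_right hC0 ?_
    refine Real.rpow_le_one_of_one_le_of_nonpos (one_le_norm_of_mem_farRegion hf) ?_
    rw [div_le_iff₀ (by positivity)] at hβ
    linarith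

/-! ### Moments of the Meijer function -/

section Moments

variable {n : ℕ} {β c : ℝ}

/-- The strict bound on `β` gives `gammaRatio` a decay exponent `δ > 0` along the ray. Division by
`Re(r - ns)`, which is linear in `x`, raises it to `1 + δ`, and Fubini applies. -/
lemma integral_Ioo_integral_horizontal (hn : 1 ≤ n) (hβ : ((n : ℝ) + 1) / (2 * n) < β)
    (hc : -(1 / (n : ℝ)) < c) (hc0 : c < 0) (r : ℕ) {y : ℝ} (hy : 1 ≤ |y|) :
    IntegrableOn (fun v : ℝ => ∫ x in Set.Iic c, (v : ℂ) ^ ((r - n * (x + y * Complex.I) : ℂ) - 1) *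
      gammaRatio n β (x + y * Complex.I)) (Set.Ioo 0 1) ∧
    ∫ v in Set.Ioo (0 : ℝ) 1, ∫ x in Set.Iic c, (v : ℂ) ^ ((r - n * (x + y * Complex.I) : ℂ) - 1) *
      gammaRatio n β (x + y * Complex.I) =
    ∫ x in Set.Iic c, gammaRatio n β (x + y * Complex.I) / (r - n * (x + y * Complex.I)) := by
  have hn0 : (0 : ℝ) < n := by exact_mod_cast hn
  have hr0 : (0 : ℝ) ≤ r := Nat.cast_nonneg r
  have hδ : 0 < n * β - ((n : ℝ) + 1) / 2 := by
    rw [div_lt_iff₀ (by positivity)] at hβ; linarith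
  obtain ⟨C, hC0, hC⟩ := exists_norm_gammaRatio_le_one_add hn (β := β) hc
  have hcont : Continuous fun x : ℝ => gammaRatio n β (x + y * Complex.I) := by
    refine continuous_iff_continuousAt.2 fun x => ?_
    refine ContinuousAt.comp (f := fun x : ℝ => (x : ℂ) + y * Complex.I)
      (differentiableAt_gammaRatio hn β (.inr ?_)).continuousAt (by fun_prop)
    have : y ≠ 0 := by rintro rfl; norm_num at hy
    simpa using this
  have hre : ∀ x : ℝ, (r - n * (x + y * Complex.I) : ℂ).re = r - n * x := by
    intro x; simp
  have hpos : ∀ x ≤ c, 0 < (r : ℝ) - n * x := fun x hx => by nlinarith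
  refine integral_Ioo_integral_cpow (γ := fun x : ℝ => (r - n * (x + y * Complex.I) : ℂ))
    (m := fun x : ℝ => gammaRatio n β (x + y * Complex.I)) ?_ hcont.aestronglyMeasurable ?_ ?_
  · exact Continuous.measurable (by fun_prop)
  · filter_upwards [ae_restrict_mem measurableSet_Iic] with x hx
    rw [hre]; exact hpos x hx
  · set w : ℝ := r / n with hw
    have hw0 : 0 ≤ w := by positivity
    set K := C * ((1 + ‖(w : ℂ)‖) / (w - c) + 1)
    refine Integrable.mono' (integrableOn_one_add_norm_rpow
      (r := 1 + (n * β - ((n : ℝ) + 1) / 2)) (by linarith) (K / n) (Set.Iic c)) ?_ ?_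
    · have h1 : AEStronglyMeasurable (fun x : ℝ => ‖gammaRatio n β (x + y * Complex.I)‖)
          (volume.restrict (Set.Iic c)) := hcont.norm.aestronglyMeasurable
      refine AEMeasurable.aestronglyMeasurable (h1.aemeasurable.div ?_)
      exact Continuous.aemeasurable (by fun_prop)
    · filter_upwards [ae_restrict_mem measurableSet_Iic] with x hx
      have hxc : x ≤ c := hx
      have h2 : w - c ≤ ‖(x : ℂ) - w‖ := by
        rw [← Complex.ofReal_sub, Complex.norm_real, Real.norm_eq_abs, abs_of_neg (by linarith)]
        linarith
      have h3 : ‖gammaRatio n β (x + y * Complex.I)‖ ≤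
          C * (1 + ‖(x : ℂ)‖) ^ (-(n * β - ((n : ℝ) + 1) / 2)) := by
        refine (hC _ (.inr (by simpa using hy))).trans ?_
        rw [show ((n : ℝ) + 1) / 2 - n * β = -(n * β - ((n : ℝ) + 1) / 2) by ring]
        refine mul_le_mul_of_nonneg_left ?_ hC0
        rw [Complex.norm_real, Real.norm_eq_abs]
        refine one_add_norm_rpow_le hδ.le ?_
        simpa using Complex.abs_re_le_norm (x + y * Complex.I)
      have h4 := norm_div_sub_le (by linarith) h2 h3
      have h5 : (r : ℝ) - n * x = n * -(x - w) := by rw [hw]; field_simp; ring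
      have h6 : ‖(x : ℂ) - w‖ = -(x - w) := by
        rw [← Complex.ofReal_sub, Complex.norm_real, Real.norm_eq_abs, abs_of_neg (by linarith)]
      have h7 : ‖(x : ℂ)‖ = |x| := by simp
      rw [norm_div, h6, h7] at h4
      rw [hre, Real.norm_eq_abs, abs_of_nonneg (div_nonneg (norm_nonneg _) (hpos x hxc).le), h5,
        mul_comm (n : ℝ), ← div_div, div_mul_eq_mul_div, div_le_div_iff_of_pos_right hn0]
      exact h4

lemma integral_Ioo_integral_segment (hn : 1 ≤ n) (β : ℝ)
    (hc : -(1 / (n : ℝ)) < c) (hc0 : c < 0) (r : ℕ) {R : ℝ} (hR : 0 ≤ R) :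
    IntegrableOn (fun v : ℝ => ∫ t in (-R)..R, (v : ℂ) ^ ((r - n * (c + t * Complex.I) : ℂ) - 1) *
      gammaRatio n β (c + t * Complex.I)) (Set.Ioo 0 1) ∧
    ∫ v in Set.Ioo (0 : ℝ) 1, ∫ t in (-R)..R, (v : ℂ) ^ ((r - n * (c + t * Complex.I) : ℂ) - 1) *
      gammaRatio n β (c + t * Complex.I) =
    ∫ t in (-R)..R, gammaRatio n β (c + t * Complex.I) / (r - n * (c + t * Complex.I)) := by
  have hn0 : (0 : ℝ) < n := by exact_mod_cast hn
  have hr0 : (0 : ℝ) ≤ r := Nat.cast_nonneg r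
  have hcont : Continuous fun t : ℝ => gammaRatio n β (c + t * Complex.I) := by
    refine continuous_iff_continuousAt.2 fun t => ?_
    refine ContinuousAt.comp (f := fun t : ℝ => (c : ℂ) + t * Complex.I)
      (differentiableAt_gammaRatio hn β (.inl ?_)).continuousAt (by fun_prop)
    simpa using hc
  have hre : ∀ t : ℝ, (r - n * (c + t * Complex.I) : ℂ).re = r - n * c := by
    intro t; simp
  have hpos : 0 < (r : ℝ) - n * c := by nlinarith
  simp only [intervalIntegral.integral_of_le (by linarith : -R ≤ R)]
  refine integral_Ioo_integral_cpow (γ := fun t : ℝ => (r - n * (c + t * Complex.I) : ℂ))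
    (m := fun t : ℝ => gammaRatio n β (c + t * Complex.I)) ?_ hcont.aestronglyMeasurable ?_ ?_
  · exact Continuous.measurable (by fun_prop)
  · exact ae_of_all _ fun t => by rw [hre]; exact hpos
  · simp only [hre]
    exact (hcont.norm.div_const _).integrableOn_Ioc

lemma integral_Ioo_shiftedLoopIntegral (hn : 1 ≤ n) (hβ : ((n : ℝ) + 1) / (2 * n) < β)
    (hc : -(1 / (n : ℝ)) < c) (hc0 : c < 0) (r : ℕ) {R : ℝ} (hR : 1 ≤ R) :
    IntegrableOn (fun v : ℝ => shiftedLoopIntegral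
      (fun s => (v : ℂ) ^ ((r - n * s : ℂ) - 1) * gammaRatio n β s) c R) (Set.Ioo 0 1) ∧
    ∫ v in Set.Ioo (0 : ℝ) 1, shiftedLoopIntegral
      (fun s => (v : ℂ) ^ ((r - n * s : ℂ) - 1) * gammaRatio n β s) c R =
    shiftedLoopIntegral (fun s => gammaRatio n β s / (r - n * s)) c R := by
  obtain ⟨a1, a2⟩ := integral_Ioo_integral_horizontal hn hβ hc hc0 r (y := R)
    (by rwa [abs_of_nonneg (by linarith)])
  obtain ⟨b1, b2⟩ := integral_Ioo_integral_horizontal hn hβ hc hc0 r (y := -R)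
    (by rwa [abs_neg, abs_of_nonneg (by linarith)])
  obtain ⟨m1, m2⟩ := integral_Ioo_integral_segment hn β hc hc0 r (R := R) (by linarith)
  simp only [Complex.ofReal_neg, neg_mul, ← sub_eq_add_neg] at b1 b2
  simp only [shiftedLoopIntegral]
  refine ⟨(b1.add (m1.const_mul Complex.I)).sub a1, ?_⟩
  refine (integral_sub (b1.add (m1.const_mul Complex.I)) a1).trans ?_
  simp only [Pi.add_apply]
  rw [integral_add b1 (m1.const_mul Complex.I), integral_const_mul, a2, b2, m2]

/-- The only singularity of `1/(r - ns)` is at `r/n`, on the other side of the line `Re s = c`. The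
loop therefore opens to that line, where Cauchy's formula evaluates `gammaRatio` at `r/n`. -/
lemma shiftedLoopIntegral_div (hn : 1 ≤ n) (hβ : ((n : ℝ) + 1) / (2 * n) < β)
    (hc : -(1 / (n : ℝ)) < c) (hc0 : c < 0) (r : ℕ) {R : ℝ} (hR : 1 ≤ R) :
    shiftedLoopIntegral (fun s => gammaRatio n β s / (r - n * s)) c R =
      2 * Real.pi * Complex.I * (gammaRatio n β (r / n) / n) := by
  have hn0 : (0 : ℝ) < n := by exact_mod_cast hn
  have hnc : (n : ℂ) ≠ 0 := by exact_mod_cast hn0.ne'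
  have hδ : 0 < n * β - ((n : ℝ) + 1) / 2 := by
    rw [div_lt_iff₀ (by positivity)] at hβ; linarith
  obtain ⟨C, hC0, hC⟩ := exists_norm_gammaRatio_le_one_add hn (β := β) hc
  rw [show ((n : ℝ) + 1) / 2 - n * β = -(n * β - ((n : ℝ) + 1) / 2) by ring] at hC
  set w : ℝ := r / n with hw
  have hw0 : 0 ≤ w := by positivity
  have hlt : ∀ s : ℂ, s.re ≤ c → w - c ≤ ‖s - w‖ := by
    intro s hs
    refine le_trans ?_ ((neg_le_abs _).trans (Complex.abs_re_le_norm _))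
    simp only [Complex.sub_re, Complex.ofReal_re]
    linarith
  have hlt' : ∀ s : ℂ, s.re ≤ c → s - w ≠ 0 := fun s hs h => by
    have := hlt s hs
    rw [h, norm_zero] at this
    linarith
  have hfac : ∀ s : ℂ, gammaRatio n β s / (r - n * s) = (gammaRatio n β s * (-1 / n)) / (s - w) := by
    intro s
    have : (r - n * s : ℂ) = -n * (s - w) := by
      rw [hw]; push_cast; field_simp; ring
    rw [this, ← div_div]
    congr 1
    rw [div_neg, neg_div, mul_neg, mul_one_div]
  have hre : ∀ s : ℂ, (s.re ≤ c ∧ R ≤ |s.im|) ∨ s.re = c → s.re ≤ c := fun s hs =>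
    hs.elim (fun h => h.1) le_of_eq
  have hloop := loop_eq_vertical (g := fun s => gammaRatio n β s / (r - n * s)) (c := c) (R := R)
    (r := 1 + (n * β - ((n : ℝ) + 1) / 2)) (C := C * (1 / n) * ((1 + ‖(w : ℂ)‖) / (w - c) + 1))
    (by linarith) ?_ ?_
  · rw [shiftedLoopIntegral, hloop]
    have hv := integral_vertical_div_sub hδ (by linarith : c < w)
      (fun s hs => differentiableAt_gammaRatio hn β (.inl (hc.trans_le hs)))
      (fun s hs => hC s (.inl hs))
    have h1 : ∀ t : ℝ, gammaRatio n β (c + t * Complex.I) / (r - n * (c + t * Complex.I)) =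
        1 / n * (gammaRatio n β (c + t * Complex.I) / (w - (c + t * Complex.I))) := by
      intro t
      rw [hfac, show (w : ℂ) - (c + t * Complex.I) = -((c + t * Complex.I) - w) by ring, div_neg]
      ring
    simp only [h1]
    rw [integral_const_mul, hv, hw]
    push_cast
    ring
  · intro s hs
    simp only [hfac]
    refine ((differentiableAt_gammaRatio hn β ?_).mul_const _).div (by fun_prop) (hlt' s (hre s hs))
    rcases hs with hs | hs
    · right
      intro h0
      rw [h0, abs_zero] at hs
      linarith [hs.2]
    · left; rw [hs]; exact hc
  · intro s hs
    simp only [hfac]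
    refine norm_div_sub_le (by linarith) (hlt s (hre s hs)) ?_
    rw [norm_mul, norm_div, norm_neg, norm_one, Complex.norm_natCast, mul_right_comm]
    gcongr
    refine hC s ?_
    rcases hs with hs | hs
    · right; linarith [hs.2]
    · left; exact hs.ge

/-- For `z = v^n` one has `v^(r-1) z^(-s) = v^((r - ns) - 1)`, so integration in `v` under the
contour replaces this power by `1/(r - ns)`. -/
theorem leRoyG_moment (hn : 1 ≤ n) (hβ : ((n : ℝ) + 1) / (2 * n) < β) (r : ℕ) :
    IntegrableOn (fun v : ℝ => (v : ℂ) ^ r * (leRoyG n β (v ^ n) / v)) (Set.Ioo 0 1) ∧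
    ∫ v in Set.Ioo (0 : ℝ) 1, (v : ℂ) ^ r * (leRoyG n β (v ^ n) / v) =
      gammaRatio n β (r / n) / n := by
  have hn0 : (0 : ℝ) < n := by exact_mod_cast hn
  set R := 1 + ((n : ℝ) + 1) / 2 with hRdef
  have hR : 1 ≤ R := by linarith
  -- Halfway between the first pole `-1/n` and `0`: right of all poles, yet with `Re(r - ns) > 0`
  -- even for `r = 0`.
  set c : ℝ := -(1 / (2 * n)) with hcdef
  have hc0 : c < 0 := by rw [hcdef, neg_lt_zero]; positivity
  have hc : -(1 / (n : ℝ)) < c := by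
    rw [hcdef, neg_lt_neg_iff]
    exact one_div_lt_one_div_of_lt hn0 (by linarith)
  have heq : ∀ v ∈ Set.Ioo (0 : ℝ) 1, (2 * Real.pi * Complex.I)⁻¹ * shiftedLoopIntegral
      (fun s => (v : ℂ) ^ ((r - n * s : ℂ) - 1) * gammaRatio n β s) c R =
      (v : ℂ) ^ r * (leRoyG n β (v ^ n) / v) := by
    intro v hv
    have hv0 : (v : ℂ) ≠ 0 := by exact_mod_cast hv.1.ne'
    have hz0 : 0 < v ^ n := pow_pos hv.1 n
    have hz1 : v ^ n < 1 := pow_lt_one₀ hv.1.le hv.2 (by lia)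
    have hpow : ∀ s : ℂ, (v : ℂ) ^ ((r - n * s : ℂ) - 1) =
        (v : ℂ) ^ r / v * ((v ^ n : ℝ) : ℂ) ^ (-s) := by
      intro s
      rw [show (r - n * s : ℂ) - 1 = (r : ℂ) - 1 + n * (-s) by ring, Complex.cpow_add _ _ hv0,
        Complex.cpow_sub _ _ hv0, Complex.cpow_one, Complex.cpow_natCast]
      congr 1
      rw [Complex.cpow_def_of_ne_zero hv0, Complex.cpow_def_of_ne_zero (by exact_mod_cast hz0.ne'),
        ← Complex.ofReal_log hv.1.le, ← Complex.ofReal_log hz0.le, Real.log_pow]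
      push_cast
      ring_nf
    have hi : ∀ y : ℝ, 1 ≤ |y| → _ := fun y hy =>
      integrableOn_Iic_integrand hn hβ.le hz0 hz1 (R := y) R hy
    have hi1 := hi R (by rwa [abs_of_nonneg (by linarith)])
    have hi2 := hi (-R) (by rwa [abs_neg, abs_of_nonneg (by linarith)])
    simp only [Complex.ofReal_neg, neg_mul, ← sub_eq_add_neg] at hi2
    rw [leRoyG_of_lt_one hn β hz0.le hz1, leftLoopIntegral_eq_shiftedLoopIntegral (c := c)
      (by linarith) ?_ hi2 hi1]
    · simp only [shiftedLoopIntegral, hpow, mul_assoc, integral_const_mul,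
        intervalIntegral.integral_const_mul]
      ring
    · intro s hs
      exact differentiableAt_integrand hn β hz0 (.inl (hc.trans_le hs))
  obtain ⟨h1, h2⟩ := integral_Ioo_shiftedLoopIntegral hn hβ hc hc0 r hR
  refine ⟨IntegrableOn.congr_fun (h1.const_mul _) heq measurableSet_Ioo, ?_⟩
  rw [← setIntegral_congr_fun measurableSet_Ioo heq, integral_const_mul, h2,
    shiftedLoopIntegral_div hn hβ hc hc0 r hR, inv_mul_cancel_left₀]
  exact Complex.two_pi_I_ne_zero

end Moments

/-! ### Gauss's multiplication formula -/

section Gauss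

/-- For a primitive root of unity `ζ` of order `m + 1`, the product of `1 - ζ^j` over `1 ≤ j ≤ m`
equals `m + 1`; the factors have modulus `2 sin(πj/(m + 1))`. -/
lemma prod_two_mul_sin (m : ℕ) :
    ∏ j ∈ Finset.range m, (2 * Real.sin (Real.pi * (((j : ℝ) + 1) / (m + 1)))) = m + 1 := by
  have h := IsPrimitiveRoot.prod_one_sub_pow_eq_order
    (Complex.isPrimitiveRoot_exp (m + 1) (Nat.succ_ne_zero m))
  have h2 := congrArg norm h
  rw [norm_prod] at h2
  have hR : ‖(m : ℂ) + 1‖ = (m : ℝ) + 1 := by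
    rw [show (m : ℂ) + 1 = ((m + 1 : ℕ) : ℂ) by push_cast; rfl, Complex.norm_natCast]
    push_cast; rfl
  rw [hR] at h2
  refine Eq.trans (Finset.prod_congr rfl fun j hj => ?_) h2
  have hj' : (j : ℝ) + 1 ≤ m := by exact_mod_cast Finset.mem_range.1 hj
  rw [← Complex.exp_nat_mul, norm_sub_rev]
  have e : (((j + 1 : ℕ) : ℂ) * (2 * Real.pi * Complex.I / ((m + 1 : ℕ) : ℂ))) =
      Complex.I * ((2 * (Real.pi * (((j : ℝ) + 1) / (m + 1))) : ℝ) : ℂ) := by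
    push_cast; ring
  have h0 : 0 ≤ Real.sin (Real.pi * (((j : ℝ) + 1) / (m + 1))) := by
    apply Real.sin_nonneg_of_nonneg_of_le_pi (by positivity)
    refine mul_le_of_le_one_right Real.pi_pos.le ?_
    rw [div_le_one (by positivity)]; linarith
  rw [e, Complex.norm_exp_I_mul_ofReal_sub_one, mul_div_cancel_left₀ _ (two_ne_zero),
    Real.norm_of_nonneg (mul_nonneg zero_le_two h0)]

/-- Reversing one copy of the product pairs `Γ(x)` with `Γ(1 - x)`. The reflection formula then
leaves a product of sines. -/
lemma prod_Gamma_sq (m : ℕ) :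
    (∏ j ∈ Finset.range m, Real.Gamma (((j : ℝ) + 1) / (m + 1))) ^ 2 =
      (2 * Real.pi) ^ m / (m + 1) := by
  have h1 : ∏ j ∈ Finset.range m, Real.Gamma (((j : ℝ) + 1) / (m + 1)) =
      ∏ j ∈ Finset.range m, Real.Gamma (1 - ((j : ℝ) + 1) / (m + 1)) := by
    rw [← Finset.prod_range_reflect]
    refine Finset.prod_congr rfl fun j hj => ?_
    have hj' := Finset.mem_range.1 hj
    have e : (((m - 1 - j : ℕ) : ℝ)) = m - 1 - j := by
      rw [Nat.sub_sub, Nat.cast_sub (by lia)]; push_cast; ring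
    rw [e]
    congr 1
    field_simp
    ring
  rw [sq]
  nth_rewrite 2 [h1]
  rw [← Finset.prod_mul_distrib]
  simp only [Real.Gamma_mul_Gamma_one_sub]
  have h2 := prod_two_mul_sin m
  rw [Finset.prod_mul_distrib, Finset.prod_const, Finset.card_range] at h2
  rw [Finset.prod_div_distrib, Finset.prod_const, Finset.card_range, mul_pow]
  generalize ∏ j ∈ Finset.range m, Real.sin (Real.pi * (((j : ℝ) + 1) / (m + 1))) = S at h2 ⊢
  rw [← h2, mul_div_mul_left _ _ (by positivity)]

lemma prod_Gamma_div {n : ℕ} (hn : 1 ≤ n) :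
    ∏ j : Fin n, Real.Gamma ((((j : ℕ) : ℝ) + 1) / n) =
      (2 * Real.pi) ^ (((n : ℝ) - 1) / 2) * (n : ℝ) ^ (-(1 / 2) : ℝ) := by
  obtain ⟨m, rfl⟩ : ∃ m, n = m + 1 := ⟨n - 1, by lia⟩
  rw [Fin.prod_univ_eq_prod_range (fun j : ℕ => Real.Gamma (((j : ℝ) + 1) / ((m + 1 : ℕ) : ℝ))),
    Finset.prod_range_succ]
  push_cast
  rw [div_self (by positivity), Real.Gamma_one, mul_one]
  have h0 : 0 ≤ ∏ j ∈ Finset.range m, Real.Gamma (((j : ℝ) + 1) / (m + 1)) :=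
    Finset.prod_nonneg fun j _ => (Real.Gamma_pos_of_pos (by positivity)).le
  rw [← Real.sqrt_sq h0, prod_Gamma_sq, Real.sqrt_eq_rpow, Real.div_rpow (by positivity)
    (by positivity), ← Real.rpow_natCast, ← Real.rpow_mul (by positivity), Real.rpow_neg
    (by positivity), div_eq_mul_inv]
  congr 2
  ring

/-- Gauss's multiplication formula at integers. -/
theorem prod_Gamma_add_natCast_div {n : ℕ} (hn : 1 ≤ n) (r : ℕ) :
    ∏ j : Fin n, Real.Gamma ((((j : ℕ) : ℝ) + 1) / n + r / n) =
      (2 * Real.pi) ^ (((n : ℝ) - 1) / 2) * (n : ℝ) ^ (-(1 / 2) : ℝ) * r.factorial / n ^ r := by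
  have hn0 : (0 : ℝ) < n := by exact_mod_cast hn
  induction r with
  | zero => simpa using prod_Gamma_div hn
  | succ r ih =>
    -- Raising `r` by one shifts the arguments by `1/n`. The factor `Γ((r + 1)/n)` leaves the
    -- product and `Γ((r + 1)/n + 1)` enters, a net factor `(r + 1)/n`.
    obtain ⟨m, rfl⟩ : ∃ m, n = m + 1 := ⟨n - 1, by lia⟩
    rw [Fin.prod_univ_eq_prod_range (fun j : ℕ => Real.Gamma (((j : ℝ) + 1) / ((m + 1 : ℕ) : ℝ) + _)),
      Finset.prod_range_succ'] at ih
    rw [Fin.prod_univ_eq_prod_range (fun j : ℕ => Real.Gamma (((j : ℝ) + 1) / ((m + 1 : ℕ) : ℝ) + _)),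
      Finset.prod_range_succ]
    have e1 : ∀ j : ℕ, ((j : ℝ) + 1) / ((m + 1 : ℕ) : ℝ) + ((r + 1 : ℕ) : ℝ) / ((m + 1 : ℕ) : ℝ) =
        (((j + 1 : ℕ) : ℝ) + 1) / ((m + 1 : ℕ) : ℝ) + r / ((m + 1 : ℕ) : ℝ) := by
      intro j; push_cast; ring
    have e2 : ((m : ℝ) + 1) / ((m + 1 : ℕ) : ℝ) + ((r + 1 : ℕ) : ℝ) / ((m + 1 : ℕ) : ℝ) =
        (((0 : ℕ) : ℝ) + 1) / ((m + 1 : ℕ) : ℝ) + r / ((m + 1 : ℕ) : ℝ) + 1 := by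
      push_cast; field_simp; ring
    rw [e2, Real.Gamma_add_one (by positivity)]
    simp only [e1]
    have e3 : (((0 : ℕ) : ℝ) + 1) / ((m + 1 : ℕ) : ℝ) + r / ((m + 1 : ℕ) : ℝ) =
      ((r : ℝ) + 1) / ((m + 1 : ℕ) : ℝ) := by push_cast; ring
    rw [mul_left_comm, ih, e3, Nat.factorial_succ, pow_succ]
    push_cast
    field_simp

end Gauss

/-! ### Functions with alternating derivatives -/

section CompletelyMonotone

/-- The functions `f` with `(-1) ^ m f⁽ᵐ⁾ ≥ 0` on the half-line `(a, ∞)`. -/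
def AlternatingDerivs (a : ℝ) (f : ℝ → ℝ) : Prop :=
  (∀ x > a, ContDiffAt ℝ ∞ f x) ∧ ∀ m : ℕ, ∀ x > a, 0 ≤ (-1 : ℝ) ^ m * iteratedDeriv m f x

/-- Leibniz's rule applied to `f' = -φ f` writes `(-1)^(m+1) f^(m+1)` as a sum of products of
nonnegative alternating derivatives of `φ` and of lower ones of `f`. -/
lemma AlternatingDerivs.of_deriv {a : ℝ} {f φ : ℝ → ℝ} (hφ : AlternatingDerivs a φ)
    (hf : ∀ x > a, ContDiffAt ℝ ∞ f x) (hf0 : ∀ x > a, 0 ≤ f x)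
    (hd : ∀ x > a, deriv f x = -(φ x * f x)) : AlternatingDerivs a f := by
  refine ⟨hf, fun m => ?_⟩
  induction m using Nat.strong_induction_on with
  | _ m ih =>
    intro x hx
    rcases m with _ | m
    · simpa using hf0 x hx
    · have hev : deriv f =ᶠ[𝓝 x] fun x => -(φ x * f x) := by
        filter_upwards [lt_mem_nhds hx] with y hy using hd y hy
      rw [iteratedDeriv_succ', hev.iteratedDeriv_eq, iteratedDeriv_fun_neg, iteratedDeriv_fun_mul
        ((hφ.1 x hx).of_le (by exact_mod_cast le_top)) ((hf x hx).of_le (by exact_mod_cast le_top)),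
        pow_succ, mul_neg_one, neg_mul_neg, Finset.mul_sum]
      refine Finset.sum_nonneg fun i hi => ?_
      have hi' : i ≤ m := Nat.lt_succ_iff.1 (Finset.mem_range.1 hi)
      have h1 := hφ.2 i x hx
      have h2 := ih (m - i) (by lia) x hx
      have h3 : (-1 : ℝ) ^ m = (-1) ^ i * (-1) ^ (m - i) := by
        rw [← pow_add, Nat.add_sub_cancel' hi']
      have h4 := mul_nonneg (mul_nonneg (Nat.cast_nonneg (m.choose i) : (0 : ℝ) ≤ _) h1) h2
      rw [h3]
      linarith

/-- Each `(-1)^m f^(m)` is antitone, its derivative being minus the next nonnegative function in the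
sequence. -/
lemma AlternatingDerivs.sub_shift {a h : ℝ} (hh : 0 ≤ h) {f : ℝ → ℝ} (hf : AlternatingDerivs a f) :
    AlternatingDerivs a fun x => f x - f (x + h) := by
  have hshift : ∀ x > a, ContDiffAt ℝ ∞ (fun x => f (x + h)) x := fun x hx =>
    ContDiffAt.comp (g := f) x (hf.1 (x + h) (by linarith)) (by fun_prop)
  refine ⟨fun x hx => (hf.1 x hx).sub (hshift x hx), fun m x hx => ?_⟩
  rw [iteratedDeriv_fun_sub ((hf.1 x hx).of_le (by exact_mod_cast le_top))
    ((hshift x hx).of_le (by exact_mod_cast le_top)), iteratedDeriv_comp_add_const]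
  have hder : ∀ y > a, HasDerivAt (fun y => (-1 : ℝ) ^ m * iteratedDeriv m f y)
      (-((-1 : ℝ) ^ (m + 1) * iteratedDeriv (m + 1) f y)) y := by
    intro y hy
    have h1 : DifferentiableAt ℝ (iteratedDeriv m f) y := by
      have := ContDiffWithinAt.differentiableWithinAt_iteratedDerivWithin (m := m)
        (hf.1 y hy).contDiffWithinAt (by exact_mod_cast ENat.natCast_lt_top m)
        (s := Set.univ) (by simp)
      simpa [iteratedDerivWithin_univ, differentiableWithinAt_univ] using this
    have h2 := h1.hasDerivAt.const_mul ((-1 : ℝ) ^ m)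
    rw [← iteratedDeriv_succ] at h2
    rwa [pow_succ, mul_neg_one, neg_mul, neg_neg]
  have hanti : AntitoneOn (fun y => (-1 : ℝ) ^ m * iteratedDeriv m f y) (Set.Ioi a) := by
    refine antitoneOn_of_deriv_nonpos (convex_Ioi a)
      (fun y hy => (hder y hy).continuousAt.continuousWithinAt) ?_ ?_
    · rw [interior_Ioi]
      exact fun y hy => (hder y hy).differentiableAt.differentiableWithinAt
    · rw [interior_Ioi]
      intro y hy
      rw [(hder y hy).deriv]
      linarith [hf.2 (m + 1) y hy]
  have := hanti (Set.mem_Ioi.2 hx) (Set.mem_Ioi.2 (by linarith : a < x + h)) (by linarith)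
  simp only at this
  linarith

/-- The alternating difference of a function with step `h`. -/
theorem AlternatingDerivs.sum_choose_nonneg {a h : ℝ} (hh : 0 ≤ h) {f : ℝ → ℝ}
    (hf : AlternatingDerivs a f) (k : ℕ) {x : ℝ} (hx : a < x) :
    0 ≤ ∑ i ∈ Finset.range (k + 1), (-1 : ℝ) ^ i * k.choose i * f (x + i * h) := by
  have h1 : 0 ≤ ((fun (g : ℝ → ℝ) x => g x - g (x + h))^[k]) f x := by
    induction k generalizing f with
    | zero => simpa using hf.2 0 x hx
    | succ k ih => rw [Function.iterate_succ_apply]; exact ih (hf.sub_shift hh)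
  have h2 : ((fun (g : ℝ → ℝ) x => g x - g (x + h))^[k]) f =
      (-1 : ℝ) ^ k • (fwdDiff h)^[k] f := by
    clear h1
    induction k with
    | zero => simp
    | succ k ih =>
      rw [Function.iterate_succ_apply', ih, Function.iterate_succ_apply']
      ext y
      simp only [Pi.smul_apply, smul_eq_mul, fwdDiff]
      ring
  rw [h2, Pi.smul_apply, fwdDiff_iter_eq_sum_shift, Finset.smul_sum] at h1
  refine h1.trans_eq (Finset.sum_congr rfl fun i hi => ?_)
  have hi' : i ≤ k := Nat.lt_succ_iff.1 (Finset.mem_range.1 hi)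
  have h3 : (-1 : ℝ) ^ k * (-1) ^ (k - i) = (-1) ^ i := by
    rw [← Nat.add_sub_cancel' hi', Nat.add_sub_cancel_left, pow_add, mul_assoc, ← pow_add,
      ← two_mul, pow_mul]
    simp
  rw [← h3]
  simp only [zsmul_eq_mul, smul_eq_mul, nsmul_eq_mul]
  push_cast
  ring

end CompletelyMonotone

/-! ### Euler's product and Hausdorff's inequalities -/

section EulerProduct

variable {n : ℕ} {β : ℝ}

/-- The quotient `∏ Γ((j + 1) / n + w) / Γ(β + w) ^ n` at a real argument. -/
noncomputable def realGammaRatio (n : ℕ) (β w : ℝ) : ℝ :=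
  (∏ j : Fin n, Real.Gamma ((((j : ℕ) : ℝ) + 1) / n + w)) / Real.Gamma (β + w) ^ n

lemma gammaRatio_ofReal (n : ℕ) (β w : ℝ) : gammaRatio n β w = realGammaRatio n β w := by
  rw [gammaRatio, realGammaRatio]
  push_cast [← Complex.Gamma_ofReal]
  rfl

/-- A partial product of Euler's product for `realGammaRatio`. -/
noncomputable def eulerPartial (n : ℕ) (β : ℝ) (N : ℕ) (w : ℝ) : ℝ :=
  ∏ k ∈ Finset.range N, ∏ j : Fin n, (β + k + w) / ((((j : ℕ) : ℝ) + 1) / n + k + w)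

/-- Up to the factor `(-1)^m m!`, differentiation yields powers of exponent `-1 - m`. These are
convex on the positive reals, so Jensen's inequality compares their average over the parameters `(j
+ 1)/n` with the value at the mean `(n + 1)/(2n)`; they also decrease, and the mean is at most `β`.
-/
lemma alternatingDerivs_inv_sub_inv (hn : 1 ≤ n) (hβ : ((n : ℝ) + 1) / (2 * n) ≤ β) (N : ℕ) :
    AlternatingDerivs (-(1 / n)) fun w => ∑ k ∈ Finset.range N, ∑ j : Fin n,
      (((((j : ℕ) : ℝ) + 1) / n + k + w)⁻¹ - (β + k + w)⁻¹) := by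
  have hn0 : (0 : ℝ) < n := by exact_mod_cast hn
  have hb : ∀ (k : ℕ) (j : Fin n) (w : ℝ), -(1 / (n : ℝ)) < w →
      0 < (((j : ℕ) : ℝ) + 1) / n + k + w := by
    intro k j w hw
    have : 1 / (n : ℝ) ≤ (((j : ℕ) : ℝ) + 1) / n := by
      gcongr; linarith [(Nat.cast_nonneg j : (0 : ℝ) ≤ ((j : ℕ) : ℝ))]
    have : (0 : ℝ) ≤ k := Nat.cast_nonneg k
    linarith
  have hmean : 1 / (n : ℝ) ≤ ((n : ℝ) + 1) / (2 * n) := by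
    rw [div_le_div_iff₀ hn0 (by positivity)]
    have : (1 : ℝ) ≤ n := by exact_mod_cast hn
    nlinarith
  have hβ0 : ∀ (k : ℕ) (w : ℝ), -(1 / (n : ℝ)) < w → 0 < β + k + w := by
    intro k w hw
    have : (0 : ℝ) ≤ k := Nat.cast_nonneg k
    linarith
  have hcd : ∀ (d w : ℝ), 0 < d + w → ∀ m : ℕ∞ω, ContDiffAt ℝ m (fun w => (d + w)⁻¹) w :=
    fun d w h m => ContDiffAt.inv (by fun_prop) h.ne'
  have hit : ∀ (d w : ℝ) (m : ℕ), iteratedDeriv m (fun w => (d + w)⁻¹) w =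
      (-1) ^ m * m.factorial * (d + w) ^ (-1 - m : ℤ) := by
    intro d w m
    have := congrFun (iter_deriv_inv_linear m (1 : ℝ) d) w
    rw [iteratedDeriv_eq_iterate]
    simpa [add_comm] using this
  refine ⟨fun w hw => ContDiffAt.sum fun k _ => ContDiffAt.sum fun j _ =>
    (hcd _ _ (hb k j w hw) _).sub (hcd _ _ (hβ0 k w hw) _), fun m w hw => ?_⟩
  rw [iteratedDeriv_fun_sum fun k _ => ContDiffAt.sum fun j _ =>
    (hcd _ _ (hb k j w hw) _).sub (hcd _ _ (hβ0 k w hw) _), Finset.mul_sum]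
  refine Finset.sum_nonneg fun k _ => ?_
  rw [iteratedDeriv_fun_sum fun j _ =>
    (hcd _ _ (hb k j w hw) _).sub (hcd _ _ (hβ0 k w hw) _)]
  have hterm : ∀ j : Fin n, iteratedDeriv m
      (fun w => (((((j : ℕ) : ℝ) + 1) / n + k + w)⁻¹ - (β + k + w)⁻¹)) w =
      (-1) ^ m * (m.factorial * (((((j : ℕ) : ℝ) + 1) / n + k + w) ^ (-1 - m : ℤ) -
        (β + k + w) ^ (-1 - m : ℤ))) := by
    intro j
    rw [iteratedDeriv_fun_sub (hcd _ _ (hb k j w hw) _) (hcd _ _ (hβ0 k w hw) _), hit, hit]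
    ring
  simp only [hterm, ← Finset.mul_sum]
  rw [← mul_assoc, ← pow_add, ← two_mul, pow_mul, neg_one_sq, one_pow, one_mul]
  refine mul_nonneg (Nat.cast_nonneg _) ?_
  rw [Finset.sum_sub_distrib, Finset.sum_const, Finset.card_univ, Fintype.card_fin, nsmul_eq_mul,
    sub_nonneg]
  have hjen := (convexOn_zpow (𝕜 := ℝ) (-1 - m : ℤ)).map_sum_le (t := Finset.univ)
    (w := fun _ : Fin n => 1 / (n : ℝ)) (p := fun j : Fin n => (((j : ℕ) : ℝ) + 1) / n + k + w)
    (fun _ _ => by positivity) (by simp [hn0.ne']) (fun j _ => hb k j w hw)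
  simp only [smul_eq_mul, ← Finset.mul_sum] at hjen
  have hsum : 1 / (n : ℝ) * ∑ j : Fin n, ((((j : ℕ) : ℝ) + 1) / n + k + w) =
      ((n : ℝ) + 1) / (2 * n) + k + w := by
    rw [Finset.sum_add_distrib, Finset.sum_add_distrib, sum_fin_succ_div hn]
    simp only [Finset.sum_const, Finset.card_univ, Fintype.card_fin, nsmul_eq_mul]
    field_simp
  rw [hsum] at hjen
  have hanti : (β + k + w) ^ (-1 - m : ℤ) ≤ (((n : ℝ) + 1) / (2 * n) + k + w) ^ (-1 - m : ℤ) := by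
    have hp : 0 < ((n : ℝ) + 1) / (2 * n) + k + w := by
      have : (0 : ℝ) ≤ k := Nat.cast_nonneg k
      linarith
    rw [show (-1 - m : ℤ) = -((m + 1 : ℕ) : ℤ) by push_cast; ring, zpow_neg, zpow_neg,
      zpow_natCast, zpow_natCast]
    gcongr
  have h2 := hanti.trans hjen
  rw [one_div, inv_mul_eq_div, le_div_iff₀ hn0] at h2
  linarith

/-- The logarithmic derivative of the product is minus the sum treated in
`alternatingDerivs_inv_sub_inv`. -/
lemma alternatingDerivs_eulerPartial (hn : 1 ≤ n) (hβ : ((n : ℝ) + 1) / (2 * n) ≤ β) (N : ℕ) :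
    AlternatingDerivs (-(1 / n)) (eulerPartial n β N) := by
  have hn0 : (0 : ℝ) < n := by exact_mod_cast hn
  have hb : ∀ (k : ℕ) (j : Fin n) (w : ℝ), -(1 / (n : ℝ)) < w →
      0 < (((j : ℕ) : ℝ) + 1) / n + k + w := by
    intro k j w hw
    have : 1 / (n : ℝ) ≤ (((j : ℕ) : ℝ) + 1) / n := by
      gcongr; linarith [(Nat.cast_nonneg j : (0 : ℝ) ≤ ((j : ℕ) : ℝ))]
    have : (0 : ℝ) ≤ k := Nat.cast_nonneg k
    linarith
  have hmean : 1 / (n : ℝ) ≤ ((n : ℝ) + 1) / (2 * n) := by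
    rw [div_le_div_iff₀ hn0 (by positivity)]
    have : (1 : ℝ) ≤ n := by exact_mod_cast hn
    nlinarith
  have hβ0 : ∀ (k : ℕ) (w : ℝ), -(1 / (n : ℝ)) < w → 0 < β + k + w := by
    intro k w hw
    have : (0 : ℝ) ≤ k := Nat.cast_nonneg k
    linarith
  have hcd : ∀ w > -(1 / (n : ℝ)), ∀ (k : ℕ) (j : Fin n), ContDiffAt ℝ ∞
      (fun w => (β + k + w) / ((((j : ℕ) : ℝ) + 1) / n + k + w)) w := fun w hw k j =>
    ContDiffAt.div (by fun_prop) (by fun_prop) (hb k j w hw).ne'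
  have hpos : ∀ w > -(1 / (n : ℝ)), ∀ (k : ℕ) (j : Fin n),
      0 < (β + k + w) / ((((j : ℕ) : ℝ) + 1) / n + k + w) := fun w hw k j =>
    div_pos (hβ0 k w hw) (hb k j w hw)
  refine (alternatingDerivs_inv_sub_inv hn hβ N).of_deriv ?_ ?_ ?_
  · intro w hw
    exact contDiffAt_prod fun k _ => contDiffAt_prod fun j _ => hcd w hw k j
  · intro w hw
    exact Finset.prod_nonneg fun k _ => Finset.prod_nonneg fun j _ => (hpos w hw k j).le
  · intro w hw
    have hne : eulerPartial n β N w ≠ 0 :=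
      Finset.prod_ne_zero_iff.2 fun k _ => Finset.prod_ne_zero_iff.2 fun j _ => (hpos w hw k j).ne'
    have hd : ∀ (k : ℕ) (j : Fin n), DifferentiableAt ℝ
        (fun w => (β + k + w) / ((((j : ℕ) : ℝ) + 1) / n + k + w)) w := fun k j =>
      (hcd w hw k j).differentiableAt (by simp)
    have h1 : logDeriv (eulerPartial n β N) w = ∑ k ∈ Finset.range N, ∑ j : Fin n,
        ((β + k + w)⁻¹ - ((((j : ℕ) : ℝ) + 1) / n + k + w)⁻¹) := by
      unfold eulerPartial
      rw [logDeriv_prod (fun k _ => Finset.prod_ne_zero_iff.2 fun j _ => (hpos w hw k j).ne')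
        (fun k _ => DifferentiableAt.fun_finsetProd fun j _ => hd k j)]
      refine Finset.sum_congr rfl fun k _ => ?_
      rw [logDeriv_prod (fun j _ => (hpos w hw k j).ne') (fun j _ => hd k j)]
      refine Finset.sum_congr rfl fun j _ => ?_
      rw [logDeriv_div w (hβ0 k w hw).ne' (hb k j w hw).ne' (by fun_prop) (by fun_prop)]
      simp [logDeriv_apply]
    rw [logDeriv_apply, div_eq_iff hne] at h1
    rw [h1, ← neg_mul, ← Finset.sum_neg_distrib]
    congr 1
    refine Finset.sum_congr rfl fun k _ => ?_
    rw [← Finset.sum_neg_distrib]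
    exact Finset.sum_congr rfl fun j _ => by ring

/-- In the quotients of Euler sequences the factorials cancel and the powers `N^((j+1)/n - β)`
combine. The index `N + 1` counts the `N + 1` linear factors of `GammaSeq`. -/
lemma tendsto_eulerPartial (hn : 1 ≤ n) {w : ℝ} (hw : 0 < β + w) :
    Tendsto (fun N : ℕ => (N : ℝ) ^ (((n : ℝ) + 1) / 2 - n * β) * eulerPartial n β (N + 1) w) atTop
      (𝓝 (realGammaRatio n β w)) := by
  have h1 : Tendsto (fun N : ℕ => ∏ j : Fin n, Real.GammaSeq ((((j : ℕ) : ℝ) + 1) / n + w) N /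
      Real.GammaSeq (β + w) N) atTop (𝓝 (∏ j : Fin n, Real.Gamma ((((j : ℕ) : ℝ) + 1) / n + w) /
      Real.Gamma (β + w))) :=
    tendsto_finsetProd _ fun j _ => (Real.GammaSeq_tendsto_Gamma _).div
      (Real.GammaSeq_tendsto_Gamma _) (Real.Gamma_pos_of_pos hw).ne'
  have h2 : ∏ j : Fin n, Real.Gamma ((((j : ℕ) : ℝ) + 1) / n + w) / Real.Gamma (β + w) =
      realGammaRatio n β w := by
    rw [realGammaRatio, Finset.prod_div_distrib]; simp
  rw [h2] at h1
  refine h1.congr' ?_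
  filter_upwards [eventually_ge_atTop 1] with N hN
  have hN0 : (0 : ℝ) < N := by exact_mod_cast hN
  have h3 : ∀ j : Fin n, Real.GammaSeq ((((j : ℕ) : ℝ) + 1) / n + w) N / Real.GammaSeq (β + w) N =
      (N : ℝ) ^ ((((j : ℕ) : ℝ) + 1) / n - β) *
        ∏ k ∈ Finset.range (N + 1), (β + k + w) / ((((j : ℕ) : ℝ) + 1) / n + k + w) := by
    intro j
    rw [Real.GammaSeq, Real.GammaSeq, Finset.prod_div_distrib, div_div_div_eq,
      Real.rpow_add hN0, Real.rpow_add hN0, Real.rpow_sub hN0]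
    have e1 : (N : ℝ) ^ w ≠ 0 := by positivity
    have e2 : (N.factorial : ℝ) ≠ 0 := by positivity
    have e3 : (N : ℝ) ^ β ≠ 0 := by positivity
    simp only [add_right_comm _ w]
    field_simp
  simp only [h3]
  rw [Finset.prod_mul_distrib, ← Real.rpow_sum_of_pos hN0, Finset.sum_sub_distrib,
    sum_fin_succ_div hn, eulerPartial, Finset.prod_comm]
  simp

/-- Hausdorff's moment condition for the sequence `M(r/n)`: differences of step `1/n` of the partial
Euler products are nonnegative. The nonnegative power of `N` preserves this, and so does the limit.
-/
theorem sum_choose_realGammaRatio_nonneg (hn : 1 ≤ n) (hβ : ((n : ℝ) + 1) / (2 * n) ≤ β)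
    (r k : ℕ) : 0 ≤ ∑ i ∈ Finset.range (k + 1),
      (-1 : ℝ) ^ i * k.choose i * realGammaRatio n β (((r + i : ℕ) : ℝ) / n) := by
  have hn0 : (0 : ℝ) < n := by exact_mod_cast hn
  have hβ0 : 0 < β := lt_of_lt_of_le (by positivity) hβ
  have hlim : Tendsto (fun N : ℕ => ∑ i ∈ Finset.range (k + 1), (-1 : ℝ) ^ i * k.choose i *
      ((N : ℝ) ^ (((n : ℝ) + 1) / 2 - n * β) * eulerPartial n β (N + 1) (((r + i : ℕ) : ℝ) / n)))
      atTop (𝓝 (∑ i ∈ Finset.range (k + 1),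
      (-1 : ℝ) ^ i * k.choose i * realGammaRatio n β (((r + i : ℕ) : ℝ) / n))) :=
    tendsto_finsetSum _ fun i _ => (tendsto_eulerPartial hn (by positivity)).const_mul _
  refine ge_of_tendsto' hlim fun N => ?_
  have h := (alternatingDerivs_eulerPartial hn hβ (N + 1)).sum_choose_nonneg
    (h := 1 / (n : ℝ)) (by positivity) k (x := r / n)
    (lt_of_lt_of_le (neg_lt_zero.2 (by positivity)) (by positivity))
  have h2 := mul_nonneg (Real.rpow_nonneg (Nat.cast_nonneg N) (((n : ℝ) + 1) / 2 - n * β)) h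
  rw [Finset.mul_sum] at h2
  refine h2.trans_eq (Finset.sum_congr rfl fun i _ => ?_)
  rw [show ((r : ℝ) / n + i * (1 / n)) = ((r + i : ℕ) : ℝ) / n by push_cast; ring]
  ring

lemma realGammaRatio_eq (hn : 1 ≤ n) (β : ℝ) (r : ℕ) :
    realGammaRatio n β (r / n) = (2 * Real.pi) ^ (((n : ℝ) - 1) / 2) * (n : ℝ) ^ (-(1 / 2) : ℝ) /
      n ^ r * (r.factorial / Real.Gamma (β + 1 / n * r) ^ n) := by
  rw [realGammaRatio, prod_Gamma_add_natCast_div hn, show β + 1 / n * r = β + r / n by ring]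
  ring

end EulerProduct

/-! ### The power series and its complete monotonicity -/

section Series

lemma tendsto_Gamma_div_Gamma_add {d : ℝ} (hd : 0 < d) :
    Tendsto (fun s : ℝ => Real.Gamma s / Real.Gamma (s + d)) atTop (𝓝 0) := by
  obtain ⟨C, hC0, hC⟩ := exists_norm_Gamma_div_le d
  have h1 : Tendsto (fun s : ℝ => C * s ^ (-d)) atTop (𝓝 0) := by
    simpa using (tendsto_rpow_neg_atTop hd).const_mul C
  refine squeeze_zero_norm' ?_ h1
  filter_upwards [eventually_ge_atTop 1] with s hs
  have h2 := hC d 0 (abs_of_pos hd).le le_rfl hd.le s (.inl (by simpa using hs))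
  rw [Complex.ofReal_zero, zero_add, zero_sub, add_comm (d : ℂ), ← Complex.ofReal_add,
    Complex.Gamma_ofReal, Complex.Gamma_ofReal, ← Complex.ofReal_div, Complex.norm_real,
    Complex.norm_real, Real.norm_of_nonneg (by linarith : 0 ≤ s)] at h2
  exact h2

theorem summable_leRoy {n : ℕ} (hn : 1 ≤ n) (β x : ℝ) :
    Summable fun r : ℕ => x ^ r / Real.Gamma (β + 1 / (n : ℝ) * r) ^ n := by
  have hn0 : (0 : ℝ) < n := by exact_mod_cast hn
  have hs : Tendsto (fun r : ℕ => β + 1 / (n : ℝ) * r) atTop atTop :=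
    tendsto_atTop_add_const_left _ _
      (Tendsto.const_mul_atTop (by positivity) tendsto_natCast_atTop_atTop)
  have hlim : Tendsto (fun r : ℕ => |x| * |Real.Gamma (β + 1 / (n : ℝ) * r) /
      Real.Gamma (β + 1 / (n : ℝ) * r + 1 / n)| ^ n) atTop (𝓝 0) := by
    have h := (((tendsto_Gamma_div_Gamma_add (by positivity : 0 < 1 / (n : ℝ))).comp hs).abs.pow
      n).const_mul |x|
    simpa [show n ≠ 0 by lia] using h
  refine summable_of_ratio_norm_eventually_le (r := 1 / 2) (by norm_num) ?_
  filter_upwards [hlim.eventually_le_const (by norm_num : (0 : ℝ) < 1 / 2),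
    hs.eventually_gt_atTop 0] with r hr hpos
  have h1 : β + 1 / (n : ℝ) * ((r + 1 : ℕ) : ℝ) = β + 1 / (n : ℝ) * r + 1 / n := by
    push_cast; ring
  have hg := (Real.Gamma_pos_of_pos hpos).ne'
  have h2 : x ^ (r + 1) / Real.Gamma (β + 1 / (n : ℝ) * r + 1 / n) ^ n =
      x * (Real.Gamma (β + 1 / (n : ℝ) * r) / Real.Gamma (β + 1 / (n : ℝ) * r + 1 / n)) ^ n *
        (x ^ r / Real.Gamma (β + 1 / (n : ℝ) * r) ^ n) := by
    rw [div_pow, pow_succ]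
    generalize Real.Gamma (β + 1 / (n : ℝ) * r) = A at hg ⊢
    generalize Real.Gamma (β + 1 / (n : ℝ) * r + 1 / n) = B
    field_simp
  rw [h1, h2, norm_mul]
  gcongr
  rwa [norm_mul, norm_pow, Real.norm_eq_abs, Real.norm_eq_abs]

/-- The exponential generating function of a sequence. -/
noncomputable def expGen (a : ℕ → ℝ) (t : ℝ) : ℝ := ∑' i : ℕ, t ^ i / i.factorial * a i

lemma norm_expGen_term_le {a : ℕ → ℝ} {K : ℝ} (ha : ∀ i, |a i| ≤ K) (t : ℝ) (i : ℕ) :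
    ‖t ^ i / i.factorial * a i‖ ≤ |t| ^ i / i.factorial * K := by
  rw [norm_mul, norm_div, norm_pow, Real.norm_eq_abs, Real.norm_eq_abs, Real.norm_eq_abs,
    Nat.abs_cast]
  gcongr
  exact ha i

lemma summable_norm_expGen {a : ℕ → ℝ} {K : ℝ} (ha : ∀ i, |a i| ≤ K) (t : ℝ) :
    Summable fun i : ℕ => ‖t ^ i / i.factorial * a i‖ :=
  Summable.of_nonneg_of_le (fun _ => norm_nonneg _) (norm_expGen_term_le ha t)
    ((Real.summable_pow_div_factorial |t|).mul_right K)

lemma hasDerivAt_expGen {a : ℕ → ℝ} {K : ℝ} (ha : ∀ i, |a i| ≤ K) (t : ℝ) :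
    HasDerivAt (expGen a) (expGen (fun i => a (i + 1)) t) t := by
  have hK : 0 ≤ K := (abs_nonneg _).trans (ha 0)
  set T := |t| + 1
  have hT : 0 ≤ T := by positivity
  -- At `i = 0` truncated subtraction makes the majorant `K`, which is harmless since the
  -- differentiated term is zero.
  have hu : Summable fun i : ℕ => (T ^ (i - 1) / (i - 1).factorial * K) := by
    rw [← summable_nat_add_iff 1]
    simpa using (Real.summable_pow_div_factorial T).mul_right K
  have hg : ∀ (i : ℕ), ∀ y ∈ Metric.ball (0 : ℝ) T, HasDerivAt (fun y => y ^ i / i.factorial * a i)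
      (i * y ^ (i - 1) / i.factorial * a i) y := fun i y _ =>
    ((hasDerivAt_pow i y).div_const _).mul_const _
  have hfac : ∀ (i : ℕ) (y : ℝ), ((i + 1 : ℕ) : ℝ) * y ^ i / (i + 1).factorial = y ^ i / i.factorial := by
    intro i y
    rw [Nat.factorial_succ]
    push_cast
    field_simp
  have hb : ∀ (i : ℕ), ∀ y ∈ Metric.ball (0 : ℝ) T, ‖i * y ^ (i - 1) / i.factorial * a i‖ ≤
      T ^ (i - 1) / (i - 1).factorial * K := by
    intro i y hy
    rcases i with _ | i
    · simpa using hK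
    · rw [Nat.add_sub_cancel, hfac]
      refine (norm_mul_le _ _).trans ?_
      rw [norm_div, norm_pow, Real.norm_natCast]
      rw [mem_ball_zero_iff] at hy
      gcongr
      exact ha _
  have h := hasDerivAt_tsum_of_isPreconnected (y₀ := t) hu Metric.isOpen_ball
    (convex_ball (0 : ℝ) T).isPreconnected hg hb (by simp [T])
    (summable_norm_expGen ha t).of_norm (by simp [T] : t ∈ _)
  have hs : Summable fun i : ℕ => i * t ^ (i - 1) / i.factorial * a i :=
    Summable.of_norm_bounded hu fun i => hb i t (by simp [T])
  rw [hs.tsum_eq_zero_add] at h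
  simp only [CharP.cast_eq_zero, zero_mul, zero_div, zero_add, Nat.add_sub_cancel, hfac] at h
  exact h

/-- The generating function of a completely monotone sequence is nonnegative at negative
arguments. -/
lemma expGen_neg_nonneg {a : ℕ → ℝ} {K : ℝ} (ha : ∀ i, |a i| ≤ K)
    (hd : ∀ k, 0 ≤ ∑ i ∈ Finset.range (k + 1), (-1 : ℝ) ^ i * k.choose i * a i) {t : ℝ}
    (ht : 0 ≤ t) : 0 ≤ expGen a (-t) := by
  -- Multiplication by `exp t` makes the `k`-th term of the Cauchy product `t^k/k!` times the `k`-th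
  -- alternating difference of `a`.
  have h1 := tsum_mul_tsum_eq_tsum_sum_antidiagonal_of_summable_norm
    (summable_norm_expGen ha (-t)) (Real.summable_pow_div_factorial t).norm
  have h2 : ∑' i : ℕ, t ^ i / i.factorial = Real.exp t := by
    rw [Real.exp_eq_exp_ℝ, NormedSpace.exp_eq_tsum_div]
  rw [h2] at h1
  refine nonneg_of_mul_nonneg_left (b := Real.exp t) ?_ (Real.exp_pos t)
  unfold expGen
  rw [h1]
  refine tsum_nonneg fun k => ?_
  rw [Finset.Nat.sum_antidiagonal_eq_sum_range_succ_mk]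
  refine (mul_nonneg (by positivity : 0 ≤ t ^ k / k.factorial) (hd k)).trans_eq ?_
  rw [Finset.mul_sum]
  refine Finset.sum_congr rfl fun i hi => ?_
  have hi' : i ≤ k := Nat.lt_succ_iff.1 (Finset.mem_range.1 hi)
  have h3 : (k.choose i : ℝ) = k.factorial / (i.factorial * (k - i).factorial) := by
    rw [Nat.cast_choose ℝ hi']
  have h4 : t ^ k = t ^ i * t ^ (k - i) := by rw [← pow_add, Nat.add_sub_cancel' hi']
  rw [h3, h4, neg_pow t]
  field_simp

variable {n : ℕ} {β : ℝ}

lemma realGammaRatio_nonneg (hn : 1 ≤ n) (hβ : ((n : ℝ) + 1) / (2 * n) ≤ β) (r : ℕ) :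
    0 ≤ realGammaRatio n β ((r : ℕ) / n) := by
  simpa using sum_choose_realGammaRatio_nonneg hn hβ r 0

/-- The case `k = 1` of Hausdorff's inequalities says that the sequence decreases, so its first term
bounds it. -/
lemma abs_realGammaRatio_le (hn : 1 ≤ n) (hβ : ((n : ℝ) + 1) / (2 * n) ≤ β) (r : ℕ) :
    |realGammaRatio n β ((r : ℕ) / n)| ≤ realGammaRatio n β 0 := by
  rw [abs_of_nonneg (realGammaRatio_nonneg hn hβ r)]
  induction r with
  | zero => simp
  | succ r ih =>
    have h := sum_choose_realGammaRatio_nonneg hn hβ r 1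
    simp only [Finset.sum_range_succ, Finset.range_zero, Finset.sum_empty] at h
    simp at h
    push_cast at h ⊢
    linarith

lemma leRoyML_eq_expGen (hn : 1 ≤ n) (β x : ℝ) :
    leRoyML (1 / n) β n x = ((2 * Real.pi) ^ (((n : ℝ) - 1) / 2) * (n : ℝ) ^ (-(1 / 2) : ℝ))⁻¹ *
      expGen (fun i => realGammaRatio n β (i / n)) (n * x) := by
  have hn0 : (0 : ℝ) < n := by exact_mod_cast hn
  rw [leRoyML, expGen, ← tsum_mul_left]
  congr 1
  ext r
  rw [realGammaRatio_eq hn]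
  have h1 : (2 * Real.pi) ^ (((n : ℝ) - 1) / 2) ≠ 0 := by positivity
  have h2 : (n : ℝ) ^ (-(1 / 2) : ℝ) ≠ 0 := by positivity
  have h3 : (r.factorial : ℝ) ≠ 0 := by positivity
  generalize (2 * Real.pi) ^ (((n : ℝ) - 1) / 2) = p at *
  generalize (n : ℝ) ^ (-(1 / 2) : ℝ) = q at *
  rw [mul_pow]
  field_simp

/-- Differentiation shifts the coefficient sequence of an exponential generating function, and
shifted sequences still satisfy Hausdorff's inequalities. The weight plays no role, so equality in
the bound for `β` is covered. -/
theorem completelyMonotoneOn_leRoyML (hn : 1 ≤ n) (hβ : ((n : ℝ) + 1) / (2 * n) ≤ β) :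
    CompletelyMonotoneOn (fun x : ℝ => leRoyML (1 / n) β n (-x)) (Set.Ioi 0) := by
  have hn0 : (0 : ℝ) < n := by exact_mod_cast hn
  set κ := ((2 * Real.pi) ^ (((n : ℝ) - 1) / 2) * (n : ℝ) ^ (-(1 / 2) : ℝ))⁻¹ with hκ
  have hκ0 : 0 ≤ κ := by positivity
  set a : ℕ → ℕ → ℝ := fun r i => realGammaRatio n β (((r + i : ℕ) : ℝ) / n) with ha
  have hab : ∀ r i, |a r i| ≤ realGammaRatio n β 0 := fun r i => abs_realGammaRatio_le hn hβ (r + i)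
  have hder : ∀ (r : ℕ) (x : ℝ), HasDerivAt (fun x => κ * (-n) ^ r * expGen (a r) (-n * x))
      (κ * (-n) ^ (r + 1) * expGen (a (r + 1)) (-n * x)) x := by
    intro r x
    have h1 : HasDerivAt (fun x : ℝ => -(n : ℝ) * x) (-n) x := by
      simpa using (hasDerivAt_id x).const_mul (-(n : ℝ))
    have h2 := ((hasDerivAt_expGen (hab r) (-n * x)).comp x h1).const_mul (κ * (-n) ^ r)
    have h3 : (fun i => a r (i + 1)) = a (r + 1) := by
      ext i; simp only [ha]; congr 3; ring
    rw [h3] at h2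
    refine h2.congr_deriv ?_
    ring
  have hit : ∀ r : ℕ, iteratedDeriv r (fun x : ℝ => leRoyML (1 / n) β n (-x)) =
      fun x => κ * (-n) ^ r * expGen (a r) (-n * x) := by
    intro r
    induction r with
    | zero =>
      ext x
      rw [iteratedDeriv_zero, leRoyML_eq_expGen hn]
      simp only [ha, zero_add, pow_zero, mul_one]
      rw [mul_neg, neg_mul]
    | succ r ih =>
      rw [iteratedDeriv_succ, ih]
      ext x
      exact (hder r x).deriv
  refine ⟨?_, fun r x hx => ?_⟩
  · refine (contDiff_of_differentiable_iteratedDeriv (n := ⊤) fun m _ => ?_).contDiffOn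
    rw [hit m]
    exact fun x => (hder m x).differentiableAt
  · rw [iteratedDerivWithin_of_isOpen isOpen_Ioi hx, hit r]
    have h1 := expGen_neg_nonneg (hab r) (sum_choose_realGammaRatio_nonneg hn hβ r)
      (t := n * x) (mul_nonneg hn0.le (le_of_lt hx))
    rw [← neg_mul] at h1
    have h2 : (-1 : ℝ) ^ r * (κ * (-n) ^ r * expGen (a r) (-n * x)) =
        κ * n ^ r * expGen (a r) (-n * x) := by
      have h3 : (-1 : ℝ) ^ r * (-1) ^ r = 1 := by rw [← mul_pow]; simp
      rw [neg_pow (n : ℝ)]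
      linear_combination (κ * n ^ r * expGen (a r) (-n * x)) * h3
    simp only
    rw [h2]
    positivity

end Series

/-! ### A density is nonnegative if its moments satisfy Hausdorff's inequalities -/

section Positivity

/-- A Bernstein polynomial of a nonnegative function is a nonnegative combination of the monomials
`v^k (1 - v)^(N - k)`. -/
lemma integral_mul_bernsteinApproximation_nonneg {ρ : ℝ → ℝ}
    (hint : IntegrableOn ρ (Set.Ioo 0 1))
    (hmom : ∀ a b : ℕ, 0 ≤ ∫ v in Set.Ioo (0 : ℝ) 1, v ^ a * (1 - v) ^ b * ρ v)
    {f : C(I, ℝ)} (hf : ∀ x, 0 ≤ f x) (N : ℕ) :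
    0 ≤ ∫ v in Set.Ioo (0 : ℝ) 1,
      bernsteinApproximation N f (Set.projIcc 0 1 zero_le_one v) * ρ v := by
  have hi : ∀ a b : ℕ, IntegrableOn (fun v : ℝ => v ^ a * (1 - v) ^ b * ρ v) (Set.Ioo 0 1) := by
    intro a b
    refine Integrable.bdd_mul (c := 1) hint (Continuous.aestronglyMeasurable (by fun_prop)) ?_
    filter_upwards [ae_restrict_mem measurableSet_Ioo] with v hv
    rw [norm_mul, norm_pow, norm_pow, Real.norm_of_nonneg hv.1.le,
      Real.norm_of_nonneg (by linarith [hv.2])]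
    exact mul_le_one₀ (pow_le_one₀ hv.1.le hv.2.le) (by have := hv.2; positivity)
      (pow_le_one₀ (by linarith [hv.2]) (by linarith [hv.1]))
  have heq : ∀ v ∈ Set.Ioo (0 : ℝ) 1,
      bernsteinApproximation N f (Set.projIcc 0 1 zero_le_one v) * ρ v =
      ∑ k : Fin (N + 1), (f (bernstein.z k) * (N.choose k)) *
        (v ^ (k : ℕ) * (1 - v) ^ (N - k) * ρ v) := by
    intro v hv
    rw [Set.projIcc_of_mem zero_le_one ⟨hv.1.le, hv.2.le⟩, bernsteinApproximation.apply,
      Finset.sum_mul]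
    refine Finset.sum_congr rfl fun k _ => ?_
    rw [bernstein_apply, smul_eq_mul]
    ring
  rw [setIntegral_congr_fun measurableSet_Ioo heq,
    integral_finsetSum _ fun k _ => (hi _ _).const_mul _]
  refine Finset.sum_nonneg fun k _ => ?_
  rw [integral_const_mul]
  exact mul_nonneg (mul_nonneg (hf _) (Nat.cast_nonneg _)) (hmom _ _)

lemma integral_continuousMap_mul_nonneg {ρ : ℝ → ℝ} (hint : IntegrableOn ρ (Set.Ioo 0 1))
    (hmom : ∀ a b : ℕ, 0 ≤ ∫ v in Set.Ioo (0 : ℝ) 1, v ^ a * (1 - v) ^ b * ρ v)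
    {f : C(I, ℝ)} (hf : ∀ x, 0 ≤ f x) :
    0 ≤ ∫ v in Set.Ioo (0 : ℝ) 1, f (Set.projIcc 0 1 zero_le_one v) * ρ v := by
  have hlim : Tendsto (fun N : ℕ => ∫ v in Set.Ioo (0 : ℝ) 1,
      bernsteinApproximation N f (Set.projIcc 0 1 zero_le_one v) * ρ v) atTop
      (𝓝 (∫ v in Set.Ioo (0 : ℝ) 1, f (Set.projIcc 0 1 zero_le_one v) * ρ v)) := by
    have hunif := bernsteinApproximation_uniform f
    have hnorm := hunif.norm.eventually_le_const (show ‖f‖ < ‖f‖ + 1 by linarith)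
    refine tendsto_integral_filter_of_dominated_convergence (fun v => (‖f‖ + 1) * ‖ρ v‖) ?_ ?_
      (hint.norm.const_mul _) ?_
    · refine Eventually.of_forall fun N => AEStronglyMeasurable.mul ?_ hint.aestronglyMeasurable
      exact ((map_continuous _).comp continuous_projIcc).aestronglyMeasurable
    · filter_upwards [hnorm] with N hN
      refine ae_of_all _ fun v => ?_
      rw [norm_mul]
      gcongr
      exact (ContinuousMap.norm_coe_le_norm _ _).trans hN
    · refine ae_of_all _ fun v => Tendsto.mul_const _ ?_
      exact ((continuous_eval_const _).tendsto f).comp hunif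
  exact ge_of_tendsto' hlim fun N => integral_mul_bernsteinApproximation_nonneg hint hmom hf N

/-- A continuous density on `(0, 1)` with completely monotone moments is nonnegative. -/
theorem nonneg_of_moments_nonneg {ρ : ℝ → ℝ} (hcont : ContinuousOn ρ (Set.Ioo 0 1))
    (hint : IntegrableOn ρ (Set.Ioo 0 1))
    (hmom : ∀ a b : ℕ, 0 ≤ ∫ v in Set.Ioo (0 : ℝ) 1, v ^ a * (1 - v) ^ b * ρ v)
    {v₀ : ℝ} (hv₀ : v₀ ∈ Set.Ioo (0 : ℝ) 1) : 0 ≤ ρ v₀ := by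
  by_contra! hneg
  have hev : ∀ᶠ v in 𝓝 v₀, v ∈ Set.Ioo (0 : ℝ) 1 ∧ ρ v < 0 :=
    (isOpen_Ioo.eventually_mem hv₀).and
      ((hcont.continuousAt (isOpen_Ioo.mem_nhds hv₀)).eventually_lt_const hneg)
  obtain ⟨ε, hε, hball⟩ := Metric.eventually_nhds_iff_ball.1 hev
  -- A tent around `v₀`, supported where the density is negative, so that its integral against the
  -- density is negative.
  let f : C(I, ℝ) := ⟨fun x => max 0 (ε - |(x : ℝ) - v₀|), by fun_prop⟩
  have hf : ∀ x, 0 ≤ f x := fun x => le_max_left _ _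
  have h1 := integral_continuousMap_mul_nonneg hint hmom hf
  have hfv : ∀ v ∈ Set.Ioo (0 : ℝ) 1, f (Set.projIcc 0 1 zero_le_one v) = max 0 (ε - |v - v₀|) := by
    intro v hv
    rw [Set.projIcc_of_mem zero_le_one ⟨hv.1.le, hv.2.le⟩]
    rfl
  rw [setIntegral_congr_fun (g := fun v => max 0 (ε - |v - v₀|) * ρ v) measurableSet_Ioo
    (fun v hv => by simp only [hfv v hv])] at h1
  have hi : IntegrableOn (fun v => max 0 (ε - |v - v₀|) * ρ v) (Set.Ioo 0 1) := by
    refine Integrable.bdd_mul (c := ε) hint (Continuous.aestronglyMeasurable (by fun_prop)) ?_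
    refine ae_of_all _ fun v => ?_
    rw [Real.norm_of_nonneg (le_max_left _ _)]
    exact max_le hε.le (by linarith [abs_nonneg (v - v₀)])
  have h2 : 0 < ∫ v in Set.Ioo (0 : ℝ) 1, -(max 0 (ε - |v - v₀|) * ρ v) := by
    refine (setIntegral_pos_iff_support_of_nonneg_ae
      (f := fun v => -(max 0 (ε - |v - v₀|) * ρ v)) ?_ hi.neg).2 ?_
    rotate_left
    · refine lt_of_lt_of_le (Metric.measure_ball_pos volume v₀ hε) (measure_mono fun v hv => ?_)
      refine ⟨?_, (hball v hv).1⟩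
      have h3 : 0 < ε - |v - v₀| := by
        rw [Metric.mem_ball, Real.dist_eq] at hv; linarith
      simp only [Function.mem_support]
      exact neg_ne_zero.2 (mul_ne_zero (lt_max_of_lt_right h3).ne' (hball v hv).2.ne)
    · filter_upwards with v
      simp only [Pi.zero_apply, Left.nonneg_neg_iff]
      rcases lt_or_ge |v - v₀| ε with h | h
      · exact mul_nonpos_of_nonneg_of_nonpos (le_max_left _ _)
          (hball v (by rwa [Metric.mem_ball, Real.dist_eq])).2.le
      · rw [max_eq_left (by linarith), zero_mul]
  rw [integral_neg] at h2
  linarith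

end Positivity

/-! ### Joint continuity in `β` and the argument -/

section Continuity

variable {n : ℕ}

/-- Dominated convergence: for `z₁ < z < z₂` the modulus of `z^(-s)` is at most the sum of those for
`z₁` and `z₂`, whatever the sign of `Re s`. At or above the threshold `gammaRatio` is bounded in the
far region, uniformly for bounded `β`. -/
lemma continuousOn_integral_integrand (hn : 1 ≤ n) {μ : Measure ℝ} {γ : ℝ → ℂ} (hγ : Continuous γ)
    (hfar : ∀ᵐ t ∂μ, γ t ∈ farRegion)
    (hfar' : ∀ t, -(1 / (n : ℝ)) < (γ t).re ∨ (γ t).im ≠ 0)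
    (hint : ∀ z : ℝ, 0 < z → z < 1 → Integrable (fun t => z ^ (-(γ t).re)) μ) :
    ContinuousOn (fun p : ℝ × ℝ => ∫ t, (p.2 : ℂ) ^ (-γ t) * gammaRatio n p.1 (γ t) ∂μ)
      (Set.Ici (((n : ℝ) + 1) / (2 * n)) ×ˢ Set.Ioo 0 1) := by
  have hn0 : (0 : ℝ) < n := by exact_mod_cast hn
  rintro ⟨β₀, z₀⟩ ⟨hβ₀, hz₀⟩
  simp only [Set.mem_Ici] at hβ₀
  simp only at hz₀
  obtain ⟨C, hC0, hC⟩ := exists_norm_gammaRatio_le hn (|β₀| + 1)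
  obtain ⟨z₁, hz₁, hz₁'⟩ := exists_between hz₀.1
  obtain ⟨z₂, hz₂, hz₂'⟩ := exists_between hz₀.2
  refine continuousWithinAt_of_dominated
    (bound := fun t => (z₁ ^ (-(γ t).re) + z₂ ^ (-(γ t).re)) * C) ?_ ?_
    (((hint z₁ hz₁ (by linarith)).add (hint z₂ (by linarith [hz₀.1]) hz₂')).mul_const C) ?_
  · filter_upwards [self_mem_nhdsWithin] with p hp
    refine (continuous_iff_continuousAt.2 fun t => ?_).aestronglyMeasurable
    exact ContinuousAt.comp (differentiableAt_integrand hn p.1 hp.2.1 (hfar' t)).continuousAt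
      hγ.continuousAt
  · have e1 : ∀ᶠ p : ℝ × ℝ in 𝓝 (β₀, z₀), z₁ < p.2 ∧ p.2 < z₂ ∧ p.1 < |β₀| + 1 := by
      have t1 : Tendsto (Prod.fst : ℝ × ℝ → ℝ) (𝓝 (β₀, z₀)) (𝓝 β₀) := continuous_fst.tendsto _
      have t2 : Tendsto (Prod.snd : ℝ × ℝ → ℝ) (𝓝 (β₀, z₀)) (𝓝 z₀) := continuous_snd.tendsto _
      exact (t2.eventually_const_lt hz₁').and ((t2.eventually_lt_const hz₂).and
        (t1.eventually_lt_const (by linarith [le_abs_self β₀])))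
    filter_upwards [self_mem_nhdsWithin, e1.filter_mono nhdsWithin_le_nhds] with p hp hp1
    filter_upwards [hfar] with t ht
    have hz0 : 0 < p.2 := hp.2.1
    have hβ : ((n : ℝ) + 1) / (2 * n) ≤ p.1 := hp.1
    have hβ0 : 0 ≤ p.1 := le_trans (by positivity) hβ
    rw [norm_mul, Complex.norm_cpow_eq_rpow_re_of_pos hz0, Complex.neg_re]
    have h1 : ‖gammaRatio n p.1 (γ t)‖ ≤ C := by
      refine (hC p.1 (by rw [abs_of_nonneg hβ0]; exact hp1.2.2.le) _ ht).trans ?_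
      refine mul_le_of_le_one_right hC0 ?_
      refine Real.rpow_le_one_of_one_le_of_nonpos (one_le_norm_of_mem_farRegion ht) ?_
      rw [div_le_iff₀ (by positivity)] at hβ
      linarith
    have h2 : p.2 ^ (-(γ t).re) ≤ z₁ ^ (-(γ t).re) + z₂ ^ (-(γ t).re) := by
      have p1 : 0 ≤ z₁ ^ (-(γ t).re) := by positivity
      have p2 : 0 ≤ z₂ ^ (-(γ t).re) := Real.rpow_nonneg (by linarith [hz₀.1]) _
      rcases le_total 0 (-(γ t).re) with h | h
      · have := Real.rpow_le_rpow hz0.le hp1.2.1.le h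
        linarith
      · have := Real.rpow_le_rpow_of_nonpos hz₁ hp1.1.le h
        linarith
    exact mul_le_mul h2 h1 (norm_nonneg _) ((Real.rpow_nonneg hz0.le _).trans h2)
  · refine ae_of_all _ fun t => ContinuousAt.continuousWithinAt (ContinuousAt.mul ?_ ?_)
    · refine ContinuousAt.cpow (by fun_prop) continuousAt_const ?_
      exact Complex.ofReal_mem_slitPlane.2 hz₀.1
    · exact (continuous_gammaRatio_param n (γ t)).continuousAt.comp continuousAt_fst

/-- Continuity in `z` gives pointwise positivity from positivity of integrals; continuity in `β`
carries it to the threshold. -/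
theorem continuousOn_leRoyG (hn : 1 ≤ n) :
    ContinuousOn (fun p : ℝ × ℝ => leRoyG n p.1 p.2)
      (Set.Ici (((n : ℝ) + 1) / (2 * n)) ×ˢ Set.Ioo 0 1) := by
  have hn0 : (0 : ℝ) < n := by exact_mod_cast hn
  set R := 1 + ((n : ℝ) + 1) / 2
  have hR : 1 ≤ R := by simp only [R]; linarith
  have hRn : -(1 / (n : ℝ)) < R := by
    have : 0 < 1 / (n : ℝ) := by positivity
    linarith
  have hhor : ∀ y : ℝ, 1 ≤ |y| → ContinuousOn (fun p : ℝ × ℝ => ∫ x in Set.Iic R,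
      (p.2 : ℂ) ^ (-(x + y * Complex.I)) * gammaRatio n p.1 (x + y * Complex.I))
      (Set.Ici (((n : ℝ) + 1) / (2 * n)) ×ˢ Set.Ioo 0 1) := by
    intro y hy
    have hy0 : y ≠ 0 := by rintro rfl; norm_num at hy
    refine continuousOn_integral_integrand hn (γ := fun x : ℝ => (x + y * Complex.I : ℂ))
      (by fun_prop) (ae_of_all _ fun x => .inr (by simpa using hy))
      (fun x => .inr (by simpa using hy0)) fun z hz0 hz1 => ?_
    simpa [IntegrableOn] using integrableOn_Iic_rpow_neg hz0 hz1 R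
  have h1 := hhor R (by rwa [abs_of_nonneg (by linarith)])
  have h2 := hhor (-R) (by rwa [abs_neg, abs_of_nonneg (by linarith)])
  simp only [Complex.ofReal_neg, neg_mul, ← sub_eq_add_neg] at h2
  have h3 : ContinuousOn (fun p : ℝ × ℝ => ∫ t in (-R)..R,
      (p.2 : ℂ) ^ (-(R + t * Complex.I)) * gammaRatio n p.1 (R + t * Complex.I))
      (Set.Ici (((n : ℝ) + 1) / (2 * n)) ×ˢ Set.Ioo 0 1) := by
    simp only [intervalIntegral.integral_of_le (by linarith : -R ≤ R)]
    refine continuousOn_integral_integrand hn (γ := fun t : ℝ => (R + t * Complex.I : ℂ))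
      (by fun_prop) (ae_of_all _ fun x => .inl (by simpa using hR))
      (fun x => .inl (by simpa using hRn)) fun z hz0 hz1 => ?_
    simp
  have h4 : ContinuousOn (fun p : ℝ × ℝ => (2 * Real.pi * Complex.I)⁻¹ *
      leftLoopIntegral (fun s => (p.2 : ℂ) ^ (-s) * gammaRatio n p.1 s) R)
      (Set.Ici (((n : ℝ) + 1) / (2 * n)) ×ˢ Set.Ioo 0 1) :=
    continuousOn_const.mul ((h2.add (continuousOn_const.mul h3)).sub h1)
  exact h4.congr fun p hp => leRoyG_of_lt_one hn p.1 hp.2.1.le hp.2.2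

end Continuity

/-! ### The weight: positivity and Laplace transform -/

section Weight

variable {n : ℕ} {β : ℝ}

/-- The weight, rescaled to the unit interval and without its constant. -/
noncomputable def leRoyDensity (n : ℕ) (β v : ℝ) : ℝ := (leRoyG n β (v ^ n)).re / v

lemma pow_mem_Ioo (hn : 1 ≤ n) {v : ℝ} (hv : v ∈ Set.Ioo (0 : ℝ) 1) :
    v ^ n ∈ Set.Ioo (0 : ℝ) 1 :=
  ⟨pow_pos hv.1 n, pow_lt_one₀ hv.1.le hv.2 (by lia)⟩

lemma leRoyDensity_moment (hn : 1 ≤ n) (hβ : ((n : ℝ) + 1) / (2 * n) < β) (r : ℕ) :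
    IntegrableOn (fun v : ℝ => v ^ r * leRoyDensity n β v) (Set.Ioo 0 1) ∧
    ∫ v in Set.Ioo (0 : ℝ) 1, v ^ r * leRoyDensity n β v = realGammaRatio n β (r / n) / n := by
  obtain ⟨h1, h2⟩ := leRoyG_moment hn hβ r
  have heq : ∀ v ∈ Set.Ioo (0 : ℝ) 1, (v : ℂ) ^ r * (leRoyG n β (v ^ n) / v) =
      ((v ^ r * leRoyDensity n β v : ℝ) : ℂ) := by
    intro v hv
    have hz := pow_mem_Ioo hn hv
    rw [leRoyDensity, ← Complex.conj_eq_iff_re.1 (conj_leRoyG hn β hz.1 hz.2)]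
    push_cast
    simp
  have h3 := IntegrableOn.congr_fun h1 heq measurableSet_Ioo
  rw [setIntegral_congr_fun measurableSet_Ioo heq, integral_complex_ofReal] at h2
  refine ⟨h3.re.congr (ae_of_all _ fun v => Complex.ofReal_re _), ?_⟩
  rw [show ((r : ℂ) / n) = ((r / n : ℝ) : ℂ) by push_cast; rfl, gammaRatio_ofReal] at h2
  exact_mod_cast h2

lemma integrableOn_leRoyDensity (hn : 1 ≤ n) (hβ : ((n : ℝ) + 1) / (2 * n) < β) :
    IntegrableOn (leRoyDensity n β) (Set.Ioo 0 1) := by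
  simpa using (leRoyDensity_moment hn hβ 0).1

/-- Expanding `(1 - v)^b` turns the integral into an alternating difference of the moments, hence of
the values of `realGammaRatio`. -/
lemma integral_pow_mul_one_sub_pow_nonneg (hn : 1 ≤ n) (hβ : ((n : ℝ) + 1) / (2 * n) < β)
    (a b : ℕ) : 0 ≤ ∫ v in Set.Ioo (0 : ℝ) 1, v ^ a * (1 - v) ^ b * leRoyDensity n β v := by
  have heq : ∀ v : ℝ, v ^ a * (1 - v) ^ b * leRoyDensity n β v =
      ∑ i ∈ Finset.range (b + 1), (-1 : ℝ) ^ i * b.choose i *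
        (v ^ (a + i) * leRoyDensity n β v) := by
    intro v
    rw [sub_eq_neg_add, add_pow, Finset.mul_sum, Finset.sum_mul]
    refine Finset.sum_congr rfl fun i _ => ?_
    rw [neg_pow, pow_add]
    ring
  simp only [heq]
  rw [integral_finsetSum _ fun i _ => (leRoyDensity_moment hn hβ (a + i)).1.const_mul _]
  simp only [integral_const_mul, fun i => (leRoyDensity_moment hn hβ (a + i)).2]
  have h := div_nonneg (sum_choose_realGammaRatio_nonneg hn hβ.le a b)
    (Nat.cast_nonneg n : (0 : ℝ) ≤ n)
  rw [Finset.sum_div] at h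
  simpa only [mul_div_assoc] using h

lemma leRoyG_re_nonneg_of_lt (hn : 1 ≤ n) (hβ : ((n : ℝ) + 1) / (2 * n) < β) {v : ℝ}
    (hv : v ∈ Set.Ioo (0 : ℝ) 1) : 0 ≤ (leRoyG n β (v ^ n)).re := by
  have hcont : ContinuousOn (leRoyDensity n β) (Set.Ioo 0 1) := by
    have h1 : ContinuousOn (fun v : ℝ => leRoyG n β (v ^ n)) (Set.Ioo 0 1) :=
      (continuousOn_leRoyG hn).comp (f := fun v : ℝ => (β, v ^ n)) (by fun_prop)
        fun v hv => ⟨hβ.le, pow_mem_Ioo hn hv⟩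
    exact (Complex.continuous_re.comp_continuousOn h1).div continuousOn_id fun v hv => hv.1.ne'
  have h := nonneg_of_moments_nonneg hcont (integrableOn_leRoyDensity hn hβ)
    (integral_pow_mul_one_sub_pow_nonneg hn hβ) hv
  rw [leRoyDensity] at h
  have h2 := mul_nonneg h hv.1.le
  rwa [div_mul_cancel₀ _ hv.1.ne'] at h2

/-- At equality the moment argument is not available; the value is a limit from larger `β`. -/
theorem leRoyG_re_nonneg (hn : 1 ≤ n) (hβ : ((n : ℝ) + 1) / (2 * n) ≤ β) {v : ℝ}
    (hv : v ∈ Set.Ioo (0 : ℝ) 1) : 0 ≤ (leRoyG n β (v ^ n)).re := by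
  have h1 : ContinuousWithinAt (fun b : ℝ => (leRoyG n b (v ^ n)).re)
      (Set.Ici (((n : ℝ) + 1) / (2 * n))) β := by
    have h2 : ContinuousOn (fun b : ℝ => leRoyG n b (v ^ n)) (Set.Ici (((n : ℝ) + 1) / (2 * n))) :=
      (continuousOn_leRoyG hn).comp (f := fun b : ℝ => (b, v ^ n)) (by fun_prop)
        fun b hb => ⟨hb, pow_mem_Ioo hn hv⟩
    exact (Complex.continuous_re.comp_continuousOn h2) β hβ
  have h3 : Tendsto (fun b : ℝ => (leRoyG n b (v ^ n)).re) (𝓝[>] β)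
      (𝓝 (leRoyG n β (v ^ n)).re) :=
    h1.mono_left (nhdsWithin_mono _ fun b hb => hβ.trans (le_of_lt hb))
  refine ge_of_tendsto h3 ?_
  filter_upwards [self_mem_nhdsWithin] with b hb
  exact leRoyG_re_nonneg_of_lt hn (hβ.trans_lt hb) hv

theorem leRoyWeight_nonneg (hn : 1 ≤ n) (hβ : ((n : ℝ) + 1) / (2 * n) ≤ β) {y : ℝ} (hy : y ≠ n) :
    0 ≤ leRoyWeight 1 n n β y := by
  have hn0 : (0 : ℝ) < n := by exact_mod_cast hn
  rcases le_or_gt y 0 with h0 | h0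
  · rw [leRoyWeight_of_nonpos n β h0]
  rcases lt_or_gt_of_ne hy with h | h
  · rw [leRoyWeight_of_pos n β h0, ← div_pow]
    exact mul_nonneg (by positivity)
      (leRoyG_re_nonneg hn hβ ⟨by positivity, (div_lt_one hn0).2 h⟩)
  · rw [leRoyWeight_eq_zero_of_lt hn β h]

lemma leRoyWeight_mul (hn : 1 ≤ n) (β : ℝ) {v : ℝ} (hv : 0 < v) :
    leRoyWeight 1 n n β (n * v) =
      ((2 * Real.pi) ^ (((n : ℝ) - 1) / 2) * (n : ℝ) ^ (-(1 / 2) : ℝ))⁻¹ * leRoyDensity n β v := by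
  have hn0 : (0 : ℝ) < n := by exact_mod_cast hn
  rw [leRoyWeight_of_pos n β (by positivity), mul_pow, mul_div_cancel_left₀ _ (by positivity),
    leRoyDensity, mul_inv, ← Real.rpow_neg (by positivity), ← Real.rpow_neg hn0.le, neg_neg,
    show -(((n : ℝ) - 1) / 2) = (1 - n) / 2 by ring, show (3 / 2 : ℝ) = 1 / 2 + 1 by norm_num,
    Real.rpow_add_one hn0.ne']
  field_simp

lemma hasSum_integral_exp_mul_leRoyDensity (hn : 1 ≤ n) (hβ : ((n : ℝ) + 1) / (2 * n) < β) (t : ℝ) :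
    IntegrableOn (fun v => Real.exp (t * v) * leRoyDensity n β v) (Set.Ioo 0 1) ∧
    ∫ v in Set.Ioo (0 : ℝ) 1, Real.exp (t * v) * leRoyDensity n β v =
      expGen (fun i => realGammaRatio n β (i / n)) t / n := by
  have hint := integrableOn_leRoyDensity hn hβ
  constructor
  · refine Integrable.bdd_mul (c := Real.exp |t|) hint
      (Continuous.aestronglyMeasurable (by fun_prop)) ?_
    filter_upwards [ae_restrict_mem measurableSet_Ioo] with v hv
    rw [Real.norm_of_nonneg (Real.exp_pos _).le, Real.exp_le_exp]
    calc t * v ≤ |t| * v := mul_le_mul_of_nonneg_right (le_abs_self t) hv.1.le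
      _ ≤ |t| := mul_le_of_le_one_right (abs_nonneg t) hv.2.le
  · have hF : ∀ i : ℕ, Integrable (fun v : ℝ => t ^ i / i.factorial * (v ^ i * leRoyDensity n β v))
        (volume.restrict (Set.Ioo 0 1)) := fun i => (leRoyDensity_moment hn hβ i).1.const_mul _
    have hbound : ∀ i : ℕ,
        ∫ v in Set.Ioo (0 : ℝ) 1, ‖t ^ i / i.factorial * (v ^ i * leRoyDensity n β v)‖ ≤
        |t| ^ i / i.factorial * ∫ v in Set.Ioo (0 : ℝ) 1, ‖leRoyDensity n β v‖ := by
      intro i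
      rw [← integral_const_mul]
      refine setIntegral_mono_on (hF i).norm (hint.norm.const_mul _) measurableSet_Ioo fun v hv => ?_
      rw [norm_mul, norm_mul, norm_div, norm_pow, norm_pow, Real.norm_natCast, Real.norm_eq_abs,
        Real.norm_of_nonneg hv.1.le]
      gcongr
      exact mul_le_of_le_one_left (norm_nonneg _) (pow_le_one₀ hv.1.le hv.2.le)
    have hs := hasSum_integral_of_summable_integral_norm hF
      (Summable.of_nonneg_of_le (fun i => integral_nonneg fun v => norm_nonneg _) hbound
        ((Real.summable_pow_div_factorial |t|).mul_right _))
    have hexp : ∀ v : ℝ, ∑' i : ℕ, t ^ i / i.factorial * (v ^ i * leRoyDensity n β v) =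
        Real.exp (t * v) * leRoyDensity n β v := by
      intro v
      rw [Real.exp_eq_exp_ℝ, NormedSpace.exp_eq_tsum_div, ← tsum_mul_right]
      congr 1
      ext i
      rw [mul_pow]
      ring
    simp only [hexp, integral_const_mul, fun i => (leRoyDensity_moment hn hβ i).2] at hs
    rw [← hs.tsum_eq, expGen, ← tsum_div_const]
    simp only [mul_div_assoc]

theorem leRoyML_eq_integral (hn : 1 ≤ n) (hβ : ((n : ℝ) + 1) / (2 * n) < β) (x : ℝ) :
    IntegrableOn (fun y : ℝ => Real.exp (-x * y) * leRoyWeight 1 n n β y) (Set.Ioi 0) ∧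
    leRoyML (1 / n) β n (-x) =
      ∫ y in Set.Ioi (0 : ℝ), Real.exp (-x * y) * leRoyWeight 1 n n β y := by
  have hn0 : (0 : ℝ) < n := by exact_mod_cast hn
  set κ := ((2 * Real.pi) ^ (((n : ℝ) - 1) / 2) * (n : ℝ) ^ (-(1 / 2) : ℝ))⁻¹ with hκ
  set g : ℝ → ℝ := fun y => Real.exp (-x * y) * leRoyWeight 1 n n β y
  obtain ⟨h1, h2⟩ := hasSum_integral_exp_mul_leRoyDensity hn hβ (n * -x)
  have heq : ∀ v ∈ Set.Ioo (0 : ℝ) 1,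
      κ * (Real.exp (n * -x * v) * leRoyDensity n β v) = g (n * v) := by
    intro v hv
    simp only [g]
    rw [leRoyWeight_mul hn β hv.1, ← hκ, show -x * (n * v) = n * -x * v by ring]
    ring
  have hsub : Set.Ioo (0 : ℝ) 1 ⊆ Set.Ioi 0 := Set.Ioo_subset_Ioi_self
  -- The point `v = 1`, that is `y = n`, must be discarded as a null set: there `z = 1` and the
  -- weight is not known to vanish.
  have hae : ∀ᵐ v : ℝ ∂volume, v ∈ Set.Ioi (0 : ℝ) \ Set.Ioo 0 1 → g (n * v) = 0 := by
    filter_upwards [compl_mem_ae_iff.2 (measure_singleton (1 : ℝ))] with v hv1 hv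
    have h3 : 1 < v := lt_of_le_of_ne (not_lt.1 fun h => hv.2 ⟨hv.1, h⟩) (Ne.symm hv1)
    simp only [g]
    rw [leRoyWeight_eq_zero_of_lt hn β (by nlinarith), mul_zero]
  have hi0 : IntegrableOn (fun v => g (n * v)) (Set.Ioo 0 1) :=
    IntegrableOn.congr_fun (h1.const_mul κ) heq measurableSet_Ioo
  have hi1 : IntegrableOn (fun v => g (n * v)) (Set.Ioi 0) :=
    hi0.of_ae_sdiff_eq_zero measurableSet_Ioi.nullMeasurableSet hae
  have hscale := integral_comp_mul_left_Ioi g 0 hn0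
  rw [mul_zero, setIntegral_eq_of_subset_of_ae_sdiff_eq_zero measurableSet_Ioi.nullMeasurableSet
    hsub hae, ← setIntegral_congr_fun measurableSet_Ioo heq, integral_const_mul, h2,
    smul_eq_mul] at hscale
  refine ⟨by simpa using (integrableOn_Ioi_comp_mul_left_iff g 0 hn0).1 hi1, ?_⟩
  change _ = ∫ y in Set.Ioi (0 : ℝ), g y
  rw [leRoyML_eq_expGen hn, ← hκ, ← mul_right_inj' (inv_ne_zero hn0.ne'), ← hscale]
  ring

end Weight

theorem mainTheorem2 (n : ℕ) (hn : 1 ≤ n) (β : ℝ) :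
    -- the weight is supported on `[0, n]`
    Function.support (leRoyWeight 1 n n β) ⊆ Set.Icc (0 : ℝ) n ∧
    -- the weight is a `G^{n,0}_{n,n}` function, cut off at `n`
    (∀ y : ℝ, 0 < y → y ≠ n →
      (leRoyWeight 1 n n β y : ℂ) =
        (((2 * Real.pi) ^ ((1 - (n : ℝ)) / 2) * (n : ℝ) ^ (3 / 2 : ℝ) / y : ℝ) : ℂ)
          * meijerGq0 (fun _ : Fin n => (β : ℂ)) (fun j : Fin n => (((j : ℕ) : ℂ) + 1) / n)
              (((y ^ n / (n : ℝ) ^ n : ℝ)) : ℂ)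
          * (if y < n then 1 else 0)) ∧
    -- the series of `F^{(n)}_{1/n,β}` converges everywhere
    (∀ x : ℝ, Summable fun r : ℕ => x ^ r / Real.Gamma (β + 1 / (n : ℝ) * r) ^ n) ∧
    -- `F^{(n)}_{1/n,β}(-x)` is the Laplace transform of the weight
    (((n : ℝ) + 1) / (2 * n) < β → ∀ x : ℝ,
      MeasureTheory.IntegrableOn (fun y : ℝ => Real.exp (-x * y) * leRoyWeight 1 n n β y)
          (Set.Ioi 0) ∧
        leRoyML (1 / n) β n (-x) =
          ∫ y in Set.Ioi (0 : ℝ), Real.exp (-x * y) * leRoyWeight 1 n n β y) ∧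
    -- nonnegativity of the weight and complete monotonicity
    (((n : ℝ) + 1) / (2 * n) ≤ β →
      (∀ y : ℝ, y ≠ n → 0 ≤ leRoyWeight 1 n n β y) ∧
      CompletelyMonotoneOn (fun x : ℝ => leRoyML (1 / n) β n (-x)) (Set.Ioi 0)) :=
  ⟨support_leRoyWeight_subset hn β, fun _ hy hyn => leRoyWeight_eq_meijer hn β hy hyn,
    summable_leRoy hn β, fun hβ x => leRoyML_eq_integral hn hβ x,
    fun hβ => ⟨fun _ hy => leRoyWeight_nonneg hn hβ hy, completelyMonotoneOn_leRoyML hn hβ⟩⟩
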